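/- Let $S^3\subset\mathbb{C}^2$ be the unit sphere, identified with $\operatorname{SU}(2)$ by sending $(z_1,z_2)$ to the matrix $\begin{pmatrix} z_1 & -\bar z_2\\ z_2 & \bar z_1\end{pmatrix}$, and let $\Gamma$ be a finite subgroup of $\operatorname{SU}(2)$, acting on $S^3\cong\operatorname{SU}(2)$ by left multiplication. Let $$\mathcal{L}=\bar z_1\frac{\partial}{\partial z_2}-\bar z_2\frac{\partial}{\partial z_1},\qquad \overline{\mathcal{L}}=z_1\frac{\partial}{\partial\bar z_2}-z_2\frac{\partial}{\partial\bar z_1},\qquad \mathcal{L}_t=\mathcal{L}+\bar t\,\overline{\mathcal{L}}\quad(t\in\mathbb{C},\ |t|<1).$$ The standard CR structure on $S^3$ is the complex line bundle in $T^{\mathbb{C}}S^3$ spanned by $\mathcal{L}$, and the Rossi CR structure with parameter $t$ is the one spanned by $\mathcal{L}_t$. Then the orbit space $S^3/\Gamma$ is Hausdorff and second countable and is a smooth manifold of dimension $3$ for which the projection $\pi:S^3\to S^3/\Gamma$ is a local diffeomorphism. If $\mathbb{L}$ is the standard CR structure, or the Rossi CR structure for any $t$ with $|t|<1$, then $\mathbb{L}/\Gamma=(d\pi)^{\mathbb{C}}(\mathbb{L})$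 is a well-defined family of subspaces of the fibers of $T^{\mathbb{C}}(S^3/\Gamma)$, and $(S^3/\Gamma,\mathbb{L}/\Gamma)$ is a strongly pseudoconvex abstract CR manifold. Here a pair $(M,\mathbb{L})$ is an abstract CR manifold if $\mathbb{L}$ is a smooth complex subbundle of $T^{\mathbb{C}}M=TM\otimes\mathbb{C}$ that is involutive (the Lie bracket of two local smooth sections of $\mathbb{L}$ is a section of $\mathbb{L}$) and satisfies $\mathbb{L}\cap\overline{\mathbb{L}}=0$; above, $\mathbb{L}/\Gamma$ has rank $1$. It is strongly pseudoconvex if $\mathbb{L}\oplus\overline{\mathbb{L}}$ has complex codimension $1$ in $T^{\mathbb{C}}M$ and at every point $p$ the Levi form $$\mathbb{L}_p\to T_p^{\mathbb{C}}M/(\mathbb{L}_p\oplus\overline{\mathbb{L}}_p),\qquad Z_p\mapsto \tfrac{1}{2i}\,[\overline{Z},Z]_p \bmod \mathbb{L}_p\oplus\overline{\mathbb{L}}_p$$ ($Z$ any local smooth section of $\mathbb{L}$ with value $Z_p$ at $p$) is well defined and definite. -/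

import Mathlib

open scoped Manifold ContDiff TensorProduct ComplexConjugate

noncomputable section

/-! ### Complexified vector spaces -/

section Complexification

variable {V : Type*} [AddCommGroup V] [Module ℝ V]

/-- The real part `ℂ ⊗ V → V`, `c ⊗ v ↦ (re c) v`. -/
def complexRe : ℂ ⊗[ℝ] V →ₗ[ℝ] V :=
  (TensorProduct.lid ℝ V).toLinearMap ∘ₗ LinearMap.rTensor V Complex.reLm

/-- The imaginary part `ℂ ⊗ V → V`, `c ⊗ v ↦ (im c) v`. -/
def complexIm : ℂ ⊗[ℝ] V →ₗ[ℝ] V :=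
  (TensorProduct.lid ℝ V).toLinearMap ∘ₗ LinearMap.rTensor V Complex.imLm

/-- Complex conjugation `ℂ ⊗ V → ℂ ⊗ V`, `c ⊗ v ↦ conj c ⊗ v`. -/
def complexConj : ℂ ⊗[ℝ] V →ₗ[ℝ] ℂ ⊗[ℝ] V :=
  LinearMap.rTensor V Complex.conjAe.toLinearMap

@[simp] theorem complexRe_tmul (c : ℂ) (v : V) : complexRe (c ⊗ₜ[ℝ] v) = c.re • v := by
  simp [complexRe]

@[simp] theorem complexIm_tmul (c : ℂ) (v : V) : complexIm (c ⊗ₜ[ℝ] v) = c.im • v := by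
  simp [complexIm]

@[simp] theorem complexConj_tmul (c : ℂ) (v : V) :
    complexConj (c ⊗ₜ[ℝ] v) = conj c ⊗ₜ[ℝ] v := by
  simp [complexConj]

theorem complexConj_smul (c : ℂ) (x : ℂ ⊗[ℝ] V) :
    complexConj (c • x) = conj c • complexConj x := by
  induction x using TensorProduct.induction_on with
  | zero => simp
  | tmul a v => simp [TensorProduct.smul_tmul']
  | add x y hx hy => simp only [smul_add, map_add, hx, hy]

theorem complexConj_complexConj (x : ℂ ⊗[ℝ] V) : complexConj (complexConj x) = x := by
  induction x using TensorProduct.induction_on with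
  | zero => simp
  | tmul a v => simp
  | add x y hx hy => simp only [map_add, hx, hy]

theorem complexRe_add_I_complexIm (x : ℂ ⊗[ℝ] V) :
    (1 : ℂ) ⊗ₜ[ℝ] complexRe x + Complex.I ⊗ₜ[ℝ] complexIm x = x := by
  induction x using TensorProduct.induction_on with
  | zero => simp
  | tmul a v =>
    rw [complexRe_tmul, complexIm_tmul, TensorProduct.tmul_smul, TensorProduct.tmul_smul,
      TensorProduct.smul_tmul', TensorProduct.smul_tmul', ← TensorProduct.add_tmul]
    congr 1
    apply Complex.ext <;> simp
  | add x y hx hy =>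
    conv_rhs => rw [← hx, ← hy]
    simp only [map_add, TensorProduct.tmul_add]
    abel

/-- The conjugate `{conj v | v ∈ S}` of a complex subspace `S` of `ℂ ⊗ V`. -/
def conjSubmodule (S : Submodule ℂ (ℂ ⊗[ℝ] V)) : Submodule ℂ (ℂ ⊗[ℝ] V) where
  carrier := {x | ∃ v ∈ S, complexConj v = x}
  add_mem' := by
    rintro _ _ ⟨v, hv, rfl⟩ ⟨w, hw, rfl⟩
    exact ⟨v + w, S.add_mem hv hw, map_add _ _ _⟩
  zero_mem' := ⟨0, S.zero_mem, map_zero _⟩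
  smul_mem' := by
    rintro c _ ⟨v, hv, rfl⟩
    exact ⟨conj c • v, S.smul_mem _ hv, by simp [complexConj_smul]⟩

end Complexification

/-! ### Abstract CR manifolds -/

section CR

variable {E : Type*} [NormedAddCommGroup E] [NormedSpace ℝ E]
  {H : Type*} [TopologicalSpace H] (I : ModelWithCorners ℝ E H)
  {M : Type*} [TopologicalSpace M] [ChartedSpace H M]
  {M' : Type*} [TopologicalSpace M'] [ChartedSpace H M']

/-- The complexified tangent space `ℂ ⊗ T_p M`. -/
abbrev CTangentSpace (p : M) : Type _ := ℂ ⊗[ℝ] TangentSpace I p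

/-- The complexification of the differential at `p` of a map `f : M → M'`. -/
def cmfderiv (f : M → M') (p : M) : CTangentSpace I p →ₗ[ℂ] CTangentSpace I (f p) :=
  (mfderiv I I f p).toLinearMap.baseChange ℂ

variable [IsManifold I ∞ M]

/-- A complex vector field is smooth on `U` if its real and imaginary parts are. -/
def CSmoothOn (Z : ∀ p : M, CTangentSpace I p) (U : Set M) : Prop :=
  ContMDiffOn I I.tangent ∞ (fun p ↦ (⟨p, complexRe (Z p)⟩ : TangentBundle I M)) U ∧
  ContMDiffOn I I.tangent ∞ (fun p ↦ (⟨p, complexIm (Z p)⟩ : TangentBundle I M)) U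

/-- The Lie bracket of complex vector fields: the complex bilinear extension of the Lie bracket
of real vector fields. -/
def cLieBracket (Z W : ∀ p : M, CTangentSpace I p) (p : M) : CTangentSpace I p :=
  (1 : ℂ) ⊗ₜ[ℝ]
      (VectorField.mlieBracket I (fun q ↦ complexRe (Z q)) (fun q ↦ complexRe (W q)) p
        - VectorField.mlieBracket I (fun q ↦ complexIm (Z q)) (fun q ↦ complexIm (W q)) p)
    + Complex.I ⊗ₜ[ℝ]
      (VectorField.mlieBracket I (fun q ↦ complexRe (Z q)) (fun q ↦ complexIm (W q)) p
        + VectorField.mlieBracket I (fun q ↦ complexIm (Z q)) (fun q ↦ complexRe (W q)) p)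

/-- `Z` is a smooth section, over the open set `U`, of the family of subspaces `L`. -/
structure IsSmoothSectionOn (L : ∀ p : M, Submodule ℂ (CTangentSpace I p))
    (Z : ∀ p : M, CTangentSpace I p) (U : Set M) : Prop where
  isOpen : IsOpen U
  smooth : CSmoothOn I Z U
  mem : ∀ p ∈ U, Z p ∈ L p

/-- `L` is a smooth complex subbundle of rank `r` of the complexified tangent bundle: every point
has a neighborhood over which `L` has a smooth frame with `r` elements. -/
def IsSmoothSubbundle (L : ∀ p : M, Submodule ℂ (CTangentSpace I p)) (r : ℕ) : Prop :=
  ∀ p : M, ∃ (U : Set M) (Z : Fin r → ∀ q : M, CTangentSpace I q), p ∈ U ∧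
    (∀ i, IsSmoothSectionOn I L (Z i) U) ∧
    ∀ q ∈ U, LinearIndependent ℂ (fun i ↦ Z i q) ∧ Submodule.span ℂ (Set.range fun i ↦ Z i q) = L q

/-- `L` is a CR bundle of rank `r` on `M`, that is, `(M, L)` is an abstract CR manifold:
`L` is a smooth involutive complex subbundle of the complexified tangent bundle
which meets its conjugate only in zero. -/
structure IsCRBundle (L : ∀ p : M, Submodule ℂ (CTangentSpace I p)) (r : ℕ) : Prop where
  subbundle : IsSmoothSubbundle I L r
  inf_conj : ∀ p : M, L p ⊓ conjSubmodule (L p) = ⊥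
  involutive : ∀ (U : Set M) (Z W : ∀ p : M, CTangentSpace I p),
    IsSmoothSectionOn I L Z U → IsSmoothSectionOn I L W U → ∀ p ∈ U, cLieBracket I Z W p ∈ L p

/-- `ℓ` is the Levi form of `L`: for every `v ∈ L_p` and every local smooth section `Z` of `L`
around `p` with `Z_p = v`, the value of `ℓ_p` at `v` is the class of `(1 / 2i) [conj Z, Z]_p`
modulo `L_p + conj L_p`. -/
def IsLeviForm (L : ∀ p : M, Submodule ℂ (CTangentSpace I p))
    (ℓ : ∀ p : M, L p → CTangentSpace I p ⧸ (L p ⊔ conjSubmodule (L p))) : Prop :=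
  ∀ (U : Set M) (Z : ∀ p : M, CTangentSpace I p) (hZ : IsSmoothSectionOn I L Z U)
    (p : M) (hp : p ∈ U),
    ℓ p ⟨Z p, hZ.mem p hp⟩ =
      Submodule.Quotient.mk
        ((1 / (2 * Complex.I)) • cLieBracket I (fun q ↦ complexConj (Z q)) Z p)

/-- `L` is of hypersurface type: `L ⊕ conj L` has complex codimension one in the complexified
tangent bundle. -/
def IsHypersurfaceType (L : ∀ p : M, Submodule ℂ (CTangentSpace I p)) : Prop :=
  ∀ p : M, Module.finrank ℂ (CTangentSpace I p ⧸ (L p ⊔ conjSubmodule (L p))) = 1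

/-- `L` is strongly pseudoconvex: it is of hypersurface type, and its Levi form is well defined and
definite at every point `p`. Definiteness is tested with a real covector `θ` that vanishes on
`L_p + conj L_p`: it is required that `θ (ℓ_p v) > 0` for all `v ≠ 0`. (Changing the sign of `θ`
exchanges positive and negative definite forms.) -/
def IsStronglyPseudoconvex (L : ∀ p : M, Submodule ℂ (CTangentSpace I p)) : Prop :=
  IsHypersurfaceType I L ∧
  ∃ ℓ : ∀ p : M, L p → CTangentSpace I p ⧸ (L p ⊔ conjSubmodule (L p)), IsLeviForm I L ℓ ∧
    ∀ p : M, ∃ θ : (CTangentSpace I p ⧸ (L p ⊔ conjSubmodule (L p))) →ₗ[ℂ] ℂ,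
      (∀ X : TangentSpace I p, (θ (Submodule.Quotient.mk ((1 : ℂ) ⊗ₜ[ℝ] X))).im = 0) ∧
      ∀ v : L p, v ≠ 0 → ∃ r : ℝ, 0 < r ∧ θ (ℓ p v) = r

/-- `L'` is the image bundle `(dπ)^ℂ (L)` of `L` under the map `π : M → M'`
(determined by `L` if `π` is surjective). -/
def IsImageBundle (π : M → M') (L : ∀ p : M, Submodule ℂ (CTangentSpace I p))
    (L' : ∀ p : M', Submodule ℂ (CTangentSpace I p)) : Prop :=
  ∀ p : M, L' (π p) = (L p).map (cmfderiv I π p)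

end CR

/-! ### The sphere and the action of `SU(2)` -/

/-- `ℂ²` with its Euclidean norm. -/
abbrev C2 : Type := EuclideanSpace ℂ (Fin 2)

/-- The unit sphere in `ℂ²`. -/
abbrev S3 : Type := Metric.sphere (0 : C2) 1

/-- The group `SU(2)`. -/
abbrev SU2 : Type := Matrix.specialUnitaryGroup (Fin 2) ℂ

instance finrank_C2_fact : Fact (Module.finrank ℝ C2 = 3 + 1) :=
  ⟨by
    rw [← Module.finrank_mul_finrank ℝ ℂ C2, Complex.finrank_real_complex]
    simp⟩

theorem S3.normSq_add (z : S3) : z.1 0 * (starRingEnd ℂ) (z.1 0) + z.1 1 * (starRingEnd ℂ) (z.1 1) = 1 := by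
  have h : ‖z.1‖ = 1 := by simp
  rw [EuclideanSpace.norm_eq, Real.sqrt_eq_one, Fin.sum_univ_two] at h
  rw [Complex.mul_conj', Complex.mul_conj']
  simpa using congrArg (fun x : ℝ ↦ (x : ℂ)) h

theorem mem_SU2_of_normSq_add {a b : ℂ} (h : a * conj a + b * conj b = 1) :
    !![a, -conj b; b, conj a] ∈ Matrix.specialUnitaryGroup (Fin 2) ℂ := by
  rw [Matrix.mem_specialUnitaryGroup_iff, Matrix.mem_unitaryGroup_iff]
  refine ⟨?_, ?_⟩
  · ext i j
    fin_cases i <;> fin_cases j <;>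
      simp [Matrix.mul_apply, Fin.sum_univ_two, Matrix.star_apply] <;>
      first | ring1 | linear_combination h
  · rw [Matrix.det_fin_two_of]
    linear_combination h

/-- The identification `S³ ≅ SU(2)`, which sends `(z₁, z₂)` to the matrix in `SU(2)` with
first column `(z₁, z₂)`. -/
def sphereEquivSU2 : S3 ≃ SU2 where
  toFun z := ⟨!![z.1 0, -((starRingEnd ℂ) (z.1 1)); z.1 1, (starRingEnd ℂ) (z.1 0)],
    mem_SU2_of_normSq_add (S3.normSq_add z)⟩
  invFun A := ⟨!₂[A.1 0 0, A.1 1 0], by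
    have h := (Matrix.mem_unitaryGroup_iff'.1 (Matrix.mem_specialUnitaryGroup_iff.1 A.2).1)
    have h0 := congrFun (congrFun h 0) 0
    simp only [Matrix.mul_apply, Fin.sum_univ_two, Matrix.star_apply, Matrix.one_apply_eq,
      RCLike.star_def, Complex.conj_mul'] at h0
    rw [mem_sphere_zero_iff_norm, EuclideanSpace.norm_eq, Real.sqrt_eq_one, Fin.sum_univ_two]
    exact_mod_cast h0⟩
  left_inv z := by
    ext i
    fin_cases i <;> simp
  right_inv A := by
    have hA := Matrix.mem_specialUnitaryGroup_iff.1 A.2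
    have h := Matrix.mem_unitaryGroup_iff'.1 hA.1
    have hadj : A.1.adjugate = star A.1 := by
      have h1 : star A.1 * A.1 * A.1.adjugate = A.1.adjugate := by rw [h, one_mul]
      rw [mul_assoc, Matrix.mul_adjugate, hA.2, one_smul, mul_one] at h1
      exact h1.symm
    have h1 := congrFun (congrFun hadj 0) 0
    have h2 := congrFun (congrFun hadj 0) 1
    simp only [Matrix.adjugate_fin_two, Matrix.star_apply, RCLike.star_def] at h1 h2
    simp at h1 h2
    apply Subtype.ext
    ext i j
    fin_cases i <;> fin_cases j <;> simp [h1, ← h2]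

/-- `SU(2)` acts on `S³ ≅ SU(2)` by left multiplication. -/
instance sphereMulAction : MulAction SU2 S3 where
  smul g z := sphereEquivSU2.symm (g * sphereEquivSU2 z)
  one_smul z := by
    change sphereEquivSU2.symm (1 * sphereEquivSU2 z) = z
    simp
  mul_smul g h z := by
    change sphereEquivSU2.symm (g * h * sphereEquivSU2 z) =
      sphereEquivSU2.symm (g * sphereEquivSU2 (sphereEquivSU2.symm (h * sphereEquivSU2 z)))
    simp [mul_assoc]

theorem sphere_smul_def (g : SU2) (z : S3) :
    g • z = sphereEquivSU2.symm (g * sphereEquivSU2 z) := rfl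

/-- In coordinates, the action is the linear action of matrices on column vectors. -/
theorem sphere_smul_coe (g : SU2) (z : S3) :
    (g • z).1 = WithLp.toLp 2 (Matrix.mulVec g.1 (WithLp.ofLp z.1)) := by
  ext i
  fin_cases i <;>
    simp [sphere_smul_def, sphereEquivSU2, Matrix.mul_apply, Matrix.mulVec, dotProduct,
      Fin.sum_univ_two]

instance sphereContinuousConstSMul (Γ : Subgroup SU2) : ContinuousConstSMul Γ S3 where
  continuous_const_smul g := by
    refine Continuous.subtype_mk (f := fun z : S3 ↦ ((g : SU2) • z).1) ?_ _
    simp only [sphere_smul_coe]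
    fun_prop

instance sphereIsCancelSMul (Γ : Subgroup SU2) : IsCancelSMul Γ S3 where
  left_cancel' g z w h := by
    have h' : sphereEquivSU2.symm ((g : SU2) * sphereEquivSU2 z) =
      sphereEquivSU2.symm ((g : SU2) * sphereEquivSU2 w) := h
    simpa using h'
  right_cancel' g g' z h := by
    have h' : sphereEquivSU2.symm ((g : SU2) * sphereEquivSU2 z) =
      sphereEquivSU2.symm ((g' : SU2) * sphereEquivSU2 z) := h
    simpa using h'

/-- The orbit space `S³ / Γ`, with the quotient topology. For finite `Γ` Mathlib makes it a charted
space, the charts being local inverses of the projection composed with charts of the sphere. -/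
abbrev SphereQuotient (Γ : Subgroup SU2) : Type := MulAction.orbitRel.Quotient Γ S3

/-- The projection `S³ → S³ / Γ`. -/
def sphereProj (Γ : Subgroup SU2) : S3 → SphereQuotient Γ := Quotient.mk _

/-! ### The standard and the Rossi CR structures on the sphere -/

/-- `∂/∂z_j = (∂/∂x_j - i ∂/∂y_j) / 2` as a complexified tangent vector of `ℂ²`. -/
def dz (j : Fin 2) : ℂ ⊗[ℝ] C2 :=
  (1 / 2 : ℂ) • ((1 : ℂ) ⊗ₜ[ℝ] EuclideanSpace.single j (1 : ℂ)
    - Complex.I ⊗ₜ[ℝ] EuclideanSpace.single j Complex.I)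

/-- `∂/∂(conj z_j) = (∂/∂x_j + i ∂/∂y_j) / 2` as a complexified tangent vector of `ℂ²`. -/
def dzbar (j : Fin 2) : ℂ ⊗[ℝ] C2 :=
  (1 / 2 : ℂ) • ((1 : ℂ) ⊗ₜ[ℝ] EuclideanSpace.single j (1 : ℂ)
    + Complex.I ⊗ₜ[ℝ] EuclideanSpace.single j Complex.I)

/-- The vector field `ℒ = conj z₁ ∂/∂z₂ - conj z₂ ∂/∂z₁`. -/
def crField (z : C2) : ℂ ⊗[ℝ] C2 :=
  (starRingEnd ℂ) (z 0) • dz 1 - (starRingEnd ℂ) (z 1) • dz 0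

/-- The conjugate vector field `conj ℒ = z₁ ∂/∂(conj z₂) - z₂ ∂/∂(conj z₁)`. -/
def crFieldBar (z : C2) : ℂ ⊗[ℝ] C2 := z 0 • dzbar 1 - z 1 • dzbar 0

/-- The vector field `ℒ_t = ℒ + conj t · conj ℒ`. -/
def rossiField (t : ℂ) (z : C2) : ℂ ⊗[ℝ] C2 := crField z + conj t • crFieldBar z

/-- The complexified differential of the inclusion of `S³` into `ℂ²`. -/
def sphereInclDeriv (z : S3) : CTangentSpace (𝓡 3) z →ₗ[ℂ] ℂ ⊗[ℝ] C2 :=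
  (mvfderiv (𝓡 3) (Subtype.val : S3 → C2) z).toLinearMap.baseChange ℂ

/-- The standard CR bundle of `S³`: the line in the complexified tangent space of the sphere
spanned by `ℒ`. -/
def standardBundle (z : S3) : Submodule ℂ (CTangentSpace (𝓡 3) z) :=
  (Submodule.span ℂ {crField z.1}).comap (sphereInclDeriv z)

/-- The CR bundle of the Rossi sphere: the line in the complexified tangent space of the sphere
spanned by `ℒ_t`. -/
def rossiBundle (t : ℂ) (z : S3) : Submodule ℂ (CTangentSpace (𝓡 3) z) :=
  (Submodule.span ℂ {rossiField t z.1}).comap (sphereInclDeriv z)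

end

/-!
On `ℂ²` the fields `a ℒ + b conj ℒ` are real-linear in the point, invariant under `SU(2)` and
tangent to the sphere, and `[a ℒ + b conj ℒ, c ℒ + d conj ℒ] = (ad - bc) R`, where
`R = ∑ z_j ∂/∂z_j - conj z_j ∂/∂(conj z_j)` generates the rotations `z ↦ exp(iθ) z`. Hence
`[conj ℒ_t, ℒ_t] = (|t|² - 1) R`, and `ℒ_t`, `conj ℒ_t` and this bracket are independent at every
point of the sphere as soon as `|t| ≠ 1`.

A finite group of left translations acts freely, so the quotient map is a local diffeomorphism; the
invariant field `ℒ_t` descends along it, and brackets of related fields are related. On a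
3-manifold, a line bundle spanned by a global field `Z` with `Z`, `conj Z`, `[conj Z, Z]`
independent is strongly pseudoconvex: the Levi form sends `f Z` to `|f|² [conj Z, Z] / 2i`, because
the other terms of `[conj (f Z), f Z]` lie in the span of `Z` and `conj Z`.
-/

noncomputable section

section Complexification

variable {V : Type*} [AddCommGroup V] [Module ℝ V] {W : Type*} [AddCommGroup W] [Module ℝ W]

theorem complexRe_smul (c : ℂ) (x : ℂ ⊗[ℝ] V) :
    complexRe (c • x) = c.re • complexRe x - c.im • complexIm x := by
  induction x using TensorProduct.induction_on with
  | zero => simp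
  | tmul a v => simp [TensorProduct.smul_tmul', sub_smul, mul_smul]
  | add x y hx hy => simp only [smul_add, map_add, hx, hy]; abel

theorem complexIm_smul (c : ℂ) (x : ℂ ⊗[ℝ] V) :
    complexIm (c • x) = c.re • complexIm x + c.im • complexRe x := by
  induction x using TensorProduct.induction_on with
  | zero => simp
  | tmul a v => simp [TensorProduct.smul_tmul', add_smul, mul_smul]
  | add x y hx hy => simp only [smul_add, map_add, hx, hy]; abel

theorem complexTensor_ext {x y : ℂ ⊗[ℝ] V} (hre : complexRe x = complexRe y)
    (him : complexIm x = complexIm y) : x = y := by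
  rw [← complexRe_add_I_complexIm x, ← complexRe_add_I_complexIm y, hre, him]

@[simp]
theorem complexRe_complexConj (x : ℂ ⊗[ℝ] V) : complexRe (complexConj x) = complexRe x := by
  induction x using TensorProduct.induction_on with
  | zero => simp
  | tmul a v => simp
  | add x y hx hy => simp only [map_add, hx, hy]

@[simp]
theorem complexIm_complexConj (x : ℂ ⊗[ℝ] V) :
    complexIm (complexConj x) = -complexIm x := by
  induction x using TensorProduct.induction_on with
  | zero => simp
  | tmul a v => simp
  | add x y hx hy => simp only [map_add, hx, hy, neg_add]

theorem complexRe_baseChange (f : V →ₗ[ℝ] W) (x : ℂ ⊗[ℝ] V) :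
    complexRe (f.baseChange ℂ x) = f (complexRe x) := by
  induction x using TensorProduct.induction_on with
  | zero => simp
  | tmul a v => simp
  | add x y hx hy => simp only [map_add, hx, hy]

theorem complexIm_baseChange (f : V →ₗ[ℝ] W) (x : ℂ ⊗[ℝ] V) :
    complexIm (f.baseChange ℂ x) = f (complexIm x) := by
  induction x using TensorProduct.induction_on with
  | zero => simp
  | tmul a v => simp
  | add x y hx hy => simp only [map_add, hx, hy]

theorem complexConj_baseChange (f : V →ₗ[ℝ] W) (x : ℂ ⊗[ℝ] V) :
    complexConj (f.baseChange ℂ x) = f.baseChange ℂ (complexConj x) := by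
  apply complexTensor_ext <;> simp [complexRe_baseChange, complexIm_baseChange]

theorem conjSubmodule_span_singleton (x : ℂ ⊗[ℝ] V) :
    conjSubmodule (Submodule.span ℂ {x}) = Submodule.span ℂ {complexConj x} := by
  ext y
  constructor
  · rintro ⟨v, hv, rfl⟩
    obtain ⟨c, rfl⟩ := Submodule.mem_span_singleton.1 hv
    rw [complexConj_smul]
    exact Submodule.smul_mem _ _ (Submodule.mem_span_singleton_self _)
  · intro hy
    obtain ⟨c, rfl⟩ := Submodule.mem_span_singleton.1 hy
    exact ⟨conj c • x, Submodule.smul_mem _ _ (Submodule.mem_span_singleton_self _),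
      by simp [complexConj_smul]⟩

/-- The complex linear extension to `ℂ ⊗ V` of a real linear functional on `V`. -/
def complexFunctional (φ : V →ₗ[ℝ] ℝ) : ℂ ⊗[ℝ] V →ₗ[ℂ] ℂ :=
  (Complex.ofRealCLM.toLinearMap ∘ₗ φ).liftBaseChange ℂ

theorem complexFunctional_eq (φ : V →ₗ[ℝ] ℝ) (x : ℂ ⊗[ℝ] V) :
    complexFunctional φ x = φ (complexRe x) + φ (complexIm x) * Complex.I := by
  conv_lhs => rw [← complexRe_add_I_complexIm x]
  simp [complexFunctional, mul_comm]

theorem exists_complexFunctional_ne_zero [TopologicalSpace V] [SeparatingDual ℝ V] {x : ℂ ⊗[ℝ] V}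
    (hx : x ≠ 0) : ∃ φ : V →L[ℝ] ℝ, complexFunctional φ.toLinearMap x ≠ 0 := by
  by_contra! h
  have hφ (φ : V →L[ℝ] ℝ) : φ (complexRe x) = 0 ∧ φ (complexIm x) = 0 := by
    have h' := Complex.ext_iff.1 ((complexFunctional_eq _ _).symm.trans (h φ))
    simpa using h'
  refine hx (complexTensor_ext ?_ ?_) <;> rw [map_zero]
  · exact SeparatingDual.eq_zero_of_forall_dual_eq_zero (R := ℝ) fun φ ↦ (hφ φ).1
  · exact SeparatingDual.eq_zero_of_forall_dual_eq_zero (R := ℝ) fun φ ↦ (hφ φ).2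

end Complexification

section Bracket

open Topology VectorField

variable {E : Type*} [NormedAddCommGroup E] [NormedSpace ℝ E]
  {H : Type*} [TopologicalSpace H] {I : ModelWithCorners ℝ E H}
  {M : Type*} [TopologicalSpace M] [ChartedSpace H M]

theorem complexRe_cLieBracket (Z W : ∀ p : M, CTangentSpace I p) (p : M) :
    complexRe (cLieBracket I Z W p) =
      mlieBracket I (fun q ↦ complexRe (Z q)) (fun q ↦ complexRe (W q)) p
        - mlieBracket I (fun q ↦ complexIm (Z q)) (fun q ↦ complexIm (W q)) p := by
  simp [cLieBracket]

theorem complexIm_cLieBracket (Z W : ∀ p : M, CTangentSpace I p) (p : M) :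
    complexIm (cLieBracket I Z W p) =
      mlieBracket I (fun q ↦ complexRe (Z q)) (fun q ↦ complexIm (W q)) p
        + mlieBracket I (fun q ↦ complexIm (Z q)) (fun q ↦ complexRe (W q)) p := by
  simp [cLieBracket]

theorem cLieBracket_swap (Z W : ∀ p : M, CTangentSpace I p) (p : M) :
    cLieBracket I Z W p = -cLieBracket I W Z p := by
  apply complexTensor_ext <;>
    simp only [map_neg, complexRe_cLieBracket, complexIm_cLieBracket,
      mlieBracket_swap_apply (V := fun q ↦ complexRe (Z q)),
      mlieBracket_swap_apply (V := fun q ↦ complexIm (Z q))] <;>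
    abel

theorem cLieBracket_self (Z : ∀ p : M, CTangentSpace I p) (p : M) : cLieBracket I Z Z p = 0 := by
  rw [cLieBracket, mlieBracket_swap_apply (V := fun q ↦ complexIm (Z q))
    (W := fun q ↦ complexRe (Z q))]
  simp

theorem cLieBracket_congr {Z Z' W W' : ∀ p : M, CTangentSpace I p} {p : M}
    (hZ : ∀ᶠ q in 𝓝 p, Z q = Z' q) (hW : ∀ᶠ q in 𝓝 p, W q = W' q) :
    cLieBracket I Z W p = cLieBracket I Z' W' p := by
  have hZre : ∀ᶠ q in 𝓝 p, complexRe (Z q) = complexRe (Z' q) := hZ.mono fun _ ↦ congrArg _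
  have hZim : ∀ᶠ q in 𝓝 p, complexIm (Z q) = complexIm (Z' q) := hZ.mono fun _ ↦ congrArg _
  have hWre : ∀ᶠ q in 𝓝 p, complexRe (W q) = complexRe (W' q) := hW.mono fun _ ↦ congrArg _
  have hWim : ∀ᶠ q in 𝓝 p, complexIm (W q) = complexIm (W' q) := hW.mono fun _ ↦ congrArg _
  simp only [cLieBracket, Filter.EventuallyEq.mlieBracket_vectorField_eq hZre hWre,
    Filter.EventuallyEq.mlieBracket_vectorField_eq hZim hWim,
    Filter.EventuallyEq.mlieBracket_vectorField_eq hZre hWim,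
    Filter.EventuallyEq.mlieBracket_vectorField_eq hZim hWre]

variable [IsManifold I ∞ M]

/-- The real and imaginary parts of the complex vector field `Z` are differentiable at `p`. -/
def CMDifferentiableAt (I : ModelWithCorners ℝ E H) [IsManifold I ∞ M]
    (Z : ∀ p : M, CTangentSpace I p) (p : M) : Prop :=
  MDifferentiableAt I I.tangent (fun q ↦ (⟨q, complexRe (Z q)⟩ : TangentBundle I M)) p ∧
  MDifferentiableAt I I.tangent (fun q ↦ (⟨q, complexIm (Z q)⟩ : TangentBundle I M)) p

theorem CSmoothOn.cmdifferentiableAt {Z : ∀ p : M, CTangentSpace I p} {U : Set M}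
    (hZ : CSmoothOn I Z U) {p : M} (hU : U ∈ 𝓝 p) : CMDifferentiableAt I Z p :=
  ⟨(hZ.1.contMDiffAt hU).mdifferentiableAt (by simp),
    (hZ.2.contMDiffAt hU).mdifferentiableAt (by simp)⟩

theorem CMDifferentiableAt.complexConj {Z : ∀ p : M, CTangentSpace I p} {p : M}
    (hZ : CMDifferentiableAt I Z p) : CMDifferentiableAt I (fun q ↦ complexConj (Z q)) p := by
  refine ⟨by simpa using hZ.1, ?_⟩
  simpa using mdifferentiableAt_neg_section hZ.2

section Leibniz

variable [CompleteSpace E]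

theorem mlieBracket_smul_add_smul_right {V W W' : ∀ p : M, TangentSpace I p} {f g : M → ℝ} {p : M}
    (hW : MDifferentiableAt I I.tangent (fun q ↦ (⟨q, W q⟩ : TangentBundle I M)) p)
    (hW' : MDifferentiableAt I I.tangent (fun q ↦ (⟨q, W' q⟩ : TangentBundle I M)) p)
    (hf : MDifferentiableAt I 𝓘(ℝ, ℝ) f p) (hg : MDifferentiableAt I 𝓘(ℝ, ℝ) g p) :
    mlieBracket I V (fun q ↦ f q • W q + g q • W' q) p =
      f p • mlieBracket I V W p + g p • mlieBracket I V W' p +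
        (mvfderiv I f p (V p) • W p + mvfderiv I g p (V p) • W' p) := calc
  _ = mlieBracket I V (f • W) p + mlieBracket I V (g • W') p :=
    mlieBracket_add_right (hf.smul_section hW) (hg.smul_section hW')
  _ = _ := by
    rw [mlieBracket_smul_right hf hW, mlieBracket_smul_right hg hW']
    abel

theorem exists_cLieBracket_smul_right (Z : ∀ p : M, CTangentSpace I p)
    {W : ∀ p : M, CTangentSpace I p} {f : M → ℂ} {p : M}
    (hf : MDifferentiableAt I 𝓘(ℝ, ℂ) f p) (hW : CMDifferentiableAt I W p) :
    ∃ k : ℂ, cLieBracket I Z (fun q ↦ f q • W q) p = f p • cLieBracket I Z W p + k • W p := by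
  have hre : MDifferentiableAt I 𝓘(ℝ, ℝ) (fun q ↦ (f q).re) p :=
    Complex.reCLM.differentiableAt.comp_mdifferentiableAt hf
  have him : MDifferentiableAt I 𝓘(ℝ, ℝ) (fun q ↦ (f q).im) p :=
    Complex.imCLM.differentiableAt.comp_mdifferentiableAt hf
  have him_neg : MDifferentiableAt I 𝓘(ℝ, ℝ) (fun q ↦ -(f q).im) p := him.neg
  have hneg : mvfderiv I (fun q ↦ -(f q).im) p = -mvfderiv I (fun q ↦ (f q).im) p := mvfderiv_neg
  have hfWre (q : M) : complexRe (f q • W q) =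
      (f q).re • complexRe (W q) + (-(f q).im) • complexIm (W q) := by
    rw [complexRe_smul, neg_smul, sub_eq_add_neg]
  let df (v : TangentSpace I p) : ℂ :=
    ⟨mvfderiv I (fun q ↦ (f q).re) p v, mvfderiv I (fun q ↦ (f q).im) p v⟩
  refine ⟨df (complexRe (Z p)) + Complex.I * df (complexIm (Z p)), ?_⟩
  apply complexTensor_ext <;>
  · simp only [complexRe_cLieBracket, complexIm_cLieBracket, hfWre, complexIm_smul,
      mlieBracket_smul_add_smul_right hW.1 hW.2 hre him_neg, hneg,
      mlieBracket_smul_add_smul_right hW.2 hW.1 hre him, map_add, complexRe_smul, df,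
      Complex.add_re, Complex.add_im, Complex.mul_re, Complex.mul_im, Complex.I_re, Complex.I_im,
      neg_apply]
    module

theorem exists_cLieBracket_smul_smul {Z W : ∀ p : M, CTangentSpace I p} {f g : M → ℂ} {p : M}
    (hf : MDifferentiableAt I 𝓘(ℝ, ℂ) f p) (hg : MDifferentiableAt I 𝓘(ℝ, ℂ) g p)
    (hZ : CMDifferentiableAt I Z p) (hW : CMDifferentiableAt I W p) :
    ∃ k l : ℂ, cLieBracket I (fun q ↦ f q • Z q) (fun q ↦ g q • W q) p =
      (f p * g p) • cLieBracket I Z W p + k • Z p + l • W p := by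
  obtain ⟨l, hl⟩ := exists_cLieBracket_smul_right (fun q ↦ f q • Z q) hg hW
  obtain ⟨k, hk⟩ := exists_cLieBracket_smul_right W hf hZ
  refine ⟨-(g p * k), l, ?_⟩
  rw [hl, cLieBracket_swap, hk, cLieBracket_swap W Z]
  module

end Leibniz

end Bracket

section ComplexLineField

open Topology

variable {E : Type*} [NormedAddCommGroup E] [NormedSpace ℝ E]
  {H : Type*} [TopologicalSpace H] {I : ModelWithCorners ℝ E H}
  {M : Type*} [TopologicalSpace M] [ChartedSpace H M] [IsManifold I ∞ M]

theorem exists_differentiable_covector_ne_zero {p : M} {x : CTangentSpace I p} (hx : x ≠ 0) :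
    ∃ ξ : ∀ q : M, CTangentSpace I q →ₗ[ℂ] ℂ, ξ p x ≠ 0 ∧
      ∀ W : ∀ q : M, CTangentSpace I q, CMDifferentiableAt I W p →
        MDifferentiableAt I 𝓘(ℝ, ℂ) (fun q ↦ ξ q (W q)) p := by
  let e := trivializationAt E (TangentSpace I) p
  have hp : p ∈ e.baseSet := FiberBundle.mem_baseSet_trivializationAt' p
  let ρ (q : M) : TangentSpace I q →L[ℝ] E := e.continuousLinearMapAt ℝ q
  have hρ {V : ∀ q : M, TangentSpace I q}
      (hV : MDifferentiableAt I I.tangent (fun q ↦ (⟨q, V q⟩ : TangentBundle I M)) p) :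
      MDifferentiableAt I 𝓘(ℝ, E) (fun q ↦ ρ q (V q)) p := by
    refine ((e.mdifferentiableAt_section_iff I _ hp).1 hV).congr_of_eventuallyEq ?_
    filter_upwards [e.open_baseSet.mem_nhds hp] with q hq
    exact e.continuousLinearMapAt_apply_of_mem ℝ hq _
  have : SeparatingDual ℝ (TangentSpace I p) := inferInstanceAs (SeparatingDual ℝ E)
  obtain ⟨φ, hφ⟩ := exists_complexFunctional_ne_zero hx
  let ψ : E →L[ℝ] ℝ := φ ∘L e.symmL ℝ p
  refine ⟨fun q ↦ complexFunctional (ψ ∘L ρ q).toLinearMap, ?_, fun W hW ↦ ?_⟩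
  · have hψ : ψ ∘L ρ p = φ := by
      ext v
      exact congrArg φ (e.symmL_continuousLinearMapAt hp v)
    change complexFunctional (ψ ∘L ρ p).toLinearMap x ≠ 0
    rwa [hψ]
  · have hre := ψ.differentiableAt.comp_mdifferentiableAt (hρ hW.1)
    have him := ψ.differentiableAt.comp_mdifferentiableAt (hρ hW.2)
    simp only [complexFunctional_eq]
    exact (Complex.ofRealCLM.differentiableAt.comp_mdifferentiableAt hre).add
      ((Complex.ofRealCLM.differentiableAt.comp_mdifferentiableAt him).mul mdifferentiableAt_const)

theorem mdifferentiableAt_of_eventually_eq_smul {Z W : ∀ q : M, CTangentSpace I q} {f : M → ℂ}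
    {p : M} (hZ : CMDifferentiableAt I Z p) (hW : CMDifferentiableAt I W p) (hZp : Z p ≠ 0)
    (hf : ∀ᶠ q in 𝓝 p, W q = f q • Z q) : MDifferentiableAt I 𝓘(ℝ, ℂ) f p := by
  obtain ⟨ξ, hξ, hdiff⟩ := exists_differentiable_covector_ne_zero hZp
  have hdiv : MDifferentiableAt I 𝓘(ℝ, ℂ) (fun q ↦ ξ q (W q) / ξ q (Z q)) p :=
    (hdiff W hW).div (hdiff Z hZ) hξ
  refine hdiv.congr_of_eventuallyEq ?_
  filter_upwards [hf, (hdiff Z hZ).continuousAt.eventually_ne hξ] with q hq hne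
  rw [hq, map_smul, smul_eq_mul, mul_div_cancel_right₀ _ hne]

section Span

variable {Z : ∀ p : M, CTangentSpace I p}

theorem isSmoothSubbundle_span_singleton (hZ : CSmoothOn I Z Set.univ) (hZ₀ : ∀ p, Z p ≠ 0) :
    IsSmoothSubbundle I (fun p ↦ Submodule.span ℂ {Z p}) 1 := fun p ↦
  ⟨Set.univ, fun _ ↦ Z, Set.mem_univ p,
    fun _ ↦ ⟨isOpen_univ, hZ, fun q _ ↦ Submodule.mem_span_singleton_self (Z q)⟩,
    fun q _ ↦ ⟨LinearIndependent.of_subsingleton 0 (hZ₀ q), by rw [Set.range_const]⟩⟩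

theorem IsSmoothSectionOn.exists_eventually_eq_smul (hZ : CSmoothOn I Z Set.univ)
    (hZ₀ : ∀ p, Z p ≠ 0) {W : ∀ p : M, CTangentSpace I p} {U : Set M}
    (hW : IsSmoothSectionOn I (fun p ↦ Submodule.span ℂ {Z p}) W U) {p : M} (hp : p ∈ U) :
    ∃ f : M → ℂ, MDifferentiableAt I 𝓘(ℝ, ℂ) f p ∧ ∀ᶠ q in 𝓝 p, W q = f q • Z q := by
  have hU : U ∈ 𝓝 p := hW.isOpen.mem_nhds hp
  have hcoeff (q : M) : ∃ c : ℂ, q ∈ U → W q = c • Z q := by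
    by_cases hq : q ∈ U
    · obtain ⟨c, hc⟩ := Submodule.mem_span_singleton.1 (hW.mem q hq)
      exact ⟨c, fun _ ↦ hc.symm⟩
    · exact ⟨0, fun h ↦ absurd h hq⟩
  choose f hf using hcoeff
  have hWf : ∀ᶠ q in 𝓝 p, W q = f q • Z q := Filter.eventually_of_mem hU hf
  exact ⟨f, mdifferentiableAt_of_eventually_eq_smul (hZ.cmdifferentiableAt Filter.univ_mem)
    (hW.smooth.cmdifferentiableAt hU) (hZ₀ p) hWf, hWf⟩

variable [CompleteSpace E]

theorem isCRBundle_span_singleton (hZ : CSmoothOn I Z Set.univ)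
    (hind : ∀ p, LinearIndependent ℂ ![Z p, complexConj (Z p)]) :
    IsCRBundle I (fun p ↦ Submodule.span ℂ {Z p}) 1 := by
  have hZ₀ (p : M) : Z p ≠ 0 := (hind p).ne_zero 0
  refine ⟨isSmoothSubbundle_span_singleton hZ hZ₀, fun p ↦ ?_, fun U V W hV hW p hp ↦ ?_⟩
  · rw [conjSubmodule_span_singleton, eq_bot_iff]
    rintro x ⟨hx, hx'⟩
    obtain ⟨a, rfl⟩ := Submodule.mem_span_singleton.1 hx
    obtain ⟨b, hb⟩ := Submodule.mem_span_singleton.1 hx'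
    have ha := (LinearIndependent.pair_iff.1 (hind p) a (-b) (by rw [neg_smul, hb]; abel)).1
    simp [ha]
  · obtain ⟨f, hf, hVf⟩ := hV.exists_eventually_eq_smul hZ hZ₀ hp
    obtain ⟨g, hg, hWg⟩ := hW.exists_eventually_eq_smul hZ hZ₀ hp
    have hZp := hZ.cmdifferentiableAt (p := p) Filter.univ_mem
    obtain ⟨k, l, hkl⟩ := exists_cLieBracket_smul_smul hf hg hZp hZp
    rw [cLieBracket_congr hVf hWg, hkl, cLieBracket_self, smul_zero, zero_add, ← add_smul]
    exact Submodule.smul_mem _ _ (Submodule.mem_span_singleton_self _)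

end Span

end ComplexLineField

section LeviForm

open Topology VectorField

theorem exists_complexFunctional_eq_I {V : Type*} [AddCommGroup V] [Module ℝ V] {x y : ℂ ⊗[ℝ] V}
    (hre : complexRe y = 0) (hy : y ∉ Submodule.span ℂ {x, complexConj x}) :
    ∃ φ : V →ₗ[ℝ] ℝ, complexFunctional φ x = 0 ∧ complexFunctional φ (complexConj x) = 0 ∧
      complexFunctional φ y = Complex.I := by
  have hyim : complexIm y ∉ Submodule.span ℝ {complexRe x, complexIm x} := by
    intro h
    obtain ⟨a, b, hab⟩ := Submodule.mem_span_pair.1 h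
    refine hy (Submodule.mem_span_pair.2
      ⟨(b + a * Complex.I) / 2, (-b + a * Complex.I) / 2, complexTensor_ext ?_ ?_⟩) <;>
      simp only [map_add, complexRe_smul, complexIm_smul, complexRe_complexConj,
        complexIm_complexConj, hre, ← hab] <;>
      match_scalars <;> simp <;> ring
  obtain ⟨φ, hφy, hφ⟩ := Submodule.exists_dual_map_eq_bot_of_notMem hyim inferInstance
  have hφx : ∀ v ∈ Submodule.span ℝ {complexRe x, complexIm x}, φ v = 0 := fun v hv ↦
    (Submodule.mem_bot ℝ).1 (hφ ▸ Submodule.mem_map_of_mem hv)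
  have hφre : φ (complexRe x) = 0 := hφx _ (Submodule.subset_span (by simp))
  have hφim : φ (complexIm x) = 0 := hφx _ (Submodule.subset_span (by simp))
  refine ⟨(φ (complexIm y))⁻¹ • φ, ?_, ?_, ?_⟩ <;>
    simp [complexFunctional_eq, hφre, hφim, hre, hφy]

variable {E : Type*} [NormedAddCommGroup E] [NormedSpace ℝ E]
  {H : Type*} [TopologicalSpace H] {I : ModelWithCorners ℝ E H}
  {M : Type*} [TopologicalSpace M] [ChartedSpace H M] {Z : ∀ p : M, CTangentSpace I p}

theorem isHypersurfaceType_span_singleton (hE : Module.finrank ℝ E = 3)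
    (hind : ∀ p, LinearIndependent ℂ ![Z p, complexConj (Z p)]) :
    IsHypersurfaceType I (fun p ↦ Submodule.span ℂ {Z p}) := by
  intro p
  have : Module.Finite ℝ E := Module.finite_of_finrank_pos (by omega)
  have : Module.Finite ℝ (TangentSpace I p) := inferInstanceAs (Module.Finite ℝ E)
  have hT : Module.finrank ℂ (CTangentSpace I p) = 3 := Module.finrank_baseChange.trans hE
  have hspan : Module.finrank ℂ ↥(Submodule.span ℂ {Z p, complexConj (Z p)}) = 2 := by
    rw [← Matrix.range_cons_cons_empty _ _ ![], finrank_span_eq_card (hind p), Fintype.card_fin]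
  have hquot := Submodule.finrank_quotient_add_finrank (Submodule.span ℂ {Z p, complexConj (Z p)})
  rw [hspan, hT] at hquot
  rw [conjSubmodule_span_singleton, ← Submodule.span_insert]
  exact Nat.add_right_cancel hquot

variable [IsManifold I ∞ M] [CompleteSpace E]

theorem complexRe_cLieBracket_complexConj_self {p : M} (hZ : CMDifferentiableAt I Z p) :
    complexRe (cLieBracket I (fun q ↦ complexConj (Z q)) Z p) = 0 := by
  have hneg : mlieBracket I (fun q ↦ -complexIm (Z q)) (fun q ↦ complexIm (Z q)) p =
      -mlieBracket I (fun q ↦ complexIm (Z q)) (fun q ↦ complexIm (Z q)) p := by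
    simpa [Pi.neg_def] using
      mlieBracket_const_smul_left (c := (-1 : ℝ)) (W := fun q ↦ complexIm (Z q)) hZ.2
  simp [complexRe_cLieBracket, hneg]

theorem exists_isLeviForm_span_singleton (hZ : CSmoothOn I Z Set.univ) (hZ₀ : ∀ p, Z p ≠ 0) :
    ∃ ℓ, IsLeviForm I (fun p ↦ Submodule.span ℂ {Z p}) ℓ ∧ ∀ p v, v ≠ 0 →
      ∃ c : ℝ, 0 < c ∧ ℓ p v = Submodule.Quotient.mk
        ((c : ℂ) • (1 / (2 * Complex.I)) • cLieBracket I (fun q ↦ complexConj (Z q)) Z p) := by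
  have hcoord (p : M) (v : Submodule.span ℂ {Z p}) : ∃ c : ℂ, c • Z p = v :=
    Submodule.mem_span_singleton.1 v.2
  choose c hc using hcoord
  refine ⟨fun p v ↦ Submodule.Quotient.mk (((‖c p v‖ ^ 2 : ℝ) : ℂ) • (1 / (2 * Complex.I)) •
    cLieBracket I (fun q ↦ complexConj (Z q)) Z p), ?_, fun p v hv ↦ ⟨_, ?_, rfl⟩⟩
  · intro U W hW p hp
    obtain ⟨f, hf, hWf⟩ := hW.exists_eventually_eq_smul hZ hZ₀ hp
    have hcf : c p ⟨W p, hW.mem p hp⟩ = f p :=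
      smul_left_injective ℂ (hZ₀ p) ((hc p _).trans hWf.self_of_nhds)
    have hWf' : ∀ᶠ q in 𝓝 p, complexConj (W q) = conj (f q) • complexConj (Z q) :=
      hWf.mono fun q hq ↦ by rw [hq, complexConj_smul]
    have hZp := hZ.cmdifferentiableAt (p := p) Filter.univ_mem
    have hf' : MDifferentiableAt I 𝓘(ℝ, ℂ) (fun q ↦ conj (f q)) p :=
      Complex.conjCLE.differentiableAt.comp_mdifferentiableAt hf
    obtain ⟨k, l, hkl⟩ := exists_cLieBracket_smul_smul hf' hf hZp.complexConj hZp
    beta_reduce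
    rw [cLieBracket_congr hWf' hWf, hkl, hcf, Complex.conj_mul', conjSubmodule_span_singleton,
      ← Submodule.span_insert]
    refine ((Submodule.Quotient.eq _).2 (Submodule.mem_span_pair.2
      ⟨-(1 / (2 * Complex.I) * l), -(1 / (2 * Complex.I) * k), ?_⟩))
    push_cast
    module
  · have hcv : c p v ≠ 0 := fun h ↦ hv (Subtype.ext (by rw [← hc p v, h, zero_smul]; rfl))
    positivity

theorem isStronglyPseudoconvex_span_singleton (hE : Module.finrank ℝ E = 3)
    (hZ : CSmoothOn I Z Set.univ) (hind : ∀ p, LinearIndependent ℂ ![Z p, complexConj (Z p)])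
    (hlevi : ∀ p, cLieBracket I (fun q ↦ complexConj (Z q)) Z p ∉
      Submodule.span ℂ {Z p, complexConj (Z p)}) :
    IsStronglyPseudoconvex I (fun p ↦ Submodule.span ℂ {Z p}) := by
  obtain ⟨ℓ, hℓ, hℓ_eq⟩ := exists_isLeviForm_span_singleton hZ fun p ↦ (hind p).ne_zero 0
  refine ⟨isHypersurfaceType_span_singleton hE hind, ℓ, hℓ, fun p ↦ ?_⟩
  obtain ⟨φ, hφ, hφconj, hφB⟩ := exists_complexFunctional_eq_I
    (complexRe_cLieBracket_complexConj_self (hZ.cmdifferentiableAt Filter.univ_mem)) (hlevi p)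
  have hker : Submodule.span ℂ {Z p} ⊔ conjSubmodule (Submodule.span ℂ {Z p}) ≤
      (complexFunctional φ).ker := by
    rw [conjSubmodule_span_singleton, sup_le_iff, Submodule.span_singleton_le_iff_mem,
      Submodule.span_singleton_le_iff_mem]
    exact ⟨hφ, hφconj⟩
  refine ⟨Submodule.liftQ _ (complexFunctional φ) hker, fun X ↦ ?_, fun v hv ↦ ?_⟩
  · rw [Submodule.liftQ_apply, complexFunctional_eq]
    simp
  · obtain ⟨c, hc, hcv⟩ := hℓ_eq p v hv
    refine ⟨c / 2, by positivity, ?_⟩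
    rw [hcv, Submodule.liftQ_apply, map_smul, map_smul, hφB, smul_eq_mul, smul_eq_mul]
    push_cast
    field_simp

end LeviForm

section Related

open VectorField Topology

variable {E : Type*} [NormedAddCommGroup E] [NormedSpace ℝ E]
  {H : Type*} [TopologicalSpace H] {I : ModelWithCorners ℝ E H}
  {M : Type*} [TopologicalSpace M] [ChartedSpace H M]

/-- The representative of the vector field `V` in the preferred chart at `x`. -/
def chartField (I : ModelWithCorners ℝ E H) (x : M) (V : ∀ q : M, TangentSpace I q) : E → E :=
  mpullbackWithin 𝓘(ℝ, E) I (extChartAt I x).symm V (Set.range I)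

variable [IsManifold I ∞ M] [I.Boundaryless]

theorem mlieBracket_eq_lieBracket_chartField (V W : ∀ q : M, TangentSpace I q) (x : M) :
    mlieBracket I V W x =
      lieBracket ℝ (chartField I x V) (chartField I x W) (extChartAt I x x) := by
  have hid (v : E) : (mfderiv I 𝓘(ℝ, E) (extChartAt I x) x).inverse v = v := by
    rw [mfderiv_extChartAt_self]
    exact DFunLike.congr_fun (ContinuousLinearMap.inverse_id (R := ℝ) (M := E)) v
  rw [← mlieBracketWithin_univ, mlieBracketWithin_apply]
  refine (hid _).trans ?_
  rw [Set.preimage_univ, Set.univ_inter, ← lieBracketWithin_univ, ← I.range_eq_univ]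
  rfl

theorem mfderiv_extChartAt_symm_chartField (V : ∀ q : M, TangentSpace I q) {x : M} {y : E}
    (hy : y ∈ (extChartAt I x).target) :
    mfderiv 𝓘(ℝ, E) I (extChartAt I x).symm y (chartField (E := E) I x V y) =
      V ((extChartAt I x).symm y) := by
  rw [← mfderivWithin_univ, ← I.range_eq_univ]
  exact (isInvertible_mfderivWithin_extChartAt_symm hy).self_apply_inverse _

theorem chartField_extChartAt (V : ∀ q : M, TangentSpace I q) {x q : M}
    (hq : q ∈ (extChartAt I x).source) :
    chartField I x V (extChartAt I x q) = mfderiv I 𝓘(ℝ, E) (extChartAt I x) q (V q) := by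
  set φ := extChartAt I x
  have hy : φ q ∈ φ.target := φ.map_source hq
  have hcomp := mfderiv_extChartAt_comp_mfderivWithin_extChartAt_symm hy
  rw [I.range_eq_univ, mfderivWithin_univ] at hcomp
  have hsymm : mfderiv I 𝓘(ℝ, E) φ (φ.symm (φ q)) (V (φ.symm (φ q))) = chartField I x V (φ q) := by
    rw [← mfderiv_extChartAt_symm_chartField V hy]
    exact DFunLike.congr_fun hcomp _
  rw [← hsymm]
  exact congrArg (fun r ↦ (mfderiv I 𝓘(ℝ, E) φ r (V r) : E)) (φ.left_inv hq)

theorem differentiableAt_chartField [CompleteSpace E] {V : ∀ q : M, TangentSpace I q} {x : M}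
    (hV : MDifferentiableAt I I.tangent (fun q ↦ (⟨q, V q⟩ : TangentBundle I M)) x) :
    DifferentiableAt ℝ (chartField I x V) (extChartAt I x x) := by
  refine (hV.mdifferentiableWithinAt
    (s := Set.univ)).differentiableWithinAt_mpullbackWithin_vectorField.differentiableAt ?_
  simp [I.range_eq_univ]

theorem contMDiffAt_extChartAt_symm_of_mem_target {x : M} {y : E}
    (hy : y ∈ (extChartAt I x).target) : ContMDiffAt 𝓘(ℝ, E) I ∞ (extChartAt I x).symm y :=
  (contMDiffOn_extChartAt_symm x).contMDiffAt ((isOpen_extChartAt_target x).mem_nhds hy)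

variable {E' : Type*} [NormedAddCommGroup E'] [NormedSpace ℝ E']
  {H' : Type*} [TopologicalSpace H'] {I' : ModelWithCorners ℝ E' H'}
  {M' : Type*} [TopologicalSpace M'] [ChartedSpace H' M'] [IsManifold I' ∞ M']
  [I'.Boundaryless] {f : M → M'}

theorem fderiv_writtenInExtChartAt_chartField (hf : ContMDiff I I' ∞ f)
    {V : ∀ q : M, TangentSpace I q} {V' : ∀ q : M', TangentSpace I' q}
    (hVV' : ∀ q, mfderiv I I' f q (V q) = V' (f q)) (x : M) :
    (fun y ↦ fderiv ℝ (writtenInExtChartAt I I' x f) y (chartField I x V y))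
      =ᶠ[𝓝 (extChartAt I x x)] chartField I' (f x) V' ∘ writtenInExtChartAt I I' x f := by
  set φ := extChartAt I x
  set ψ := extChartAt I' (f x)
  have hsource : ∀ᶠ y in 𝓝 (φ x), f (φ.symm y) ∈ ψ.source := by
    have hc : ContinuousAt (f ∘ φ.symm) (φ x) :=
      hf.continuous.continuousAt.comp (continuousAt_extChartAt_symm x)
    refine hc (extChartAt_source_mem_nhds' ?_)
    simp [φ]
  filter_upwards [extChartAt_target_mem_nhds x, hsource] with y hy hfy
  have hφ : MDifferentiableAt 𝓘(ℝ, E) I φ.symm y :=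
    (contMDiffAt_extChartAt_symm_of_mem_target hy).mdifferentiableAt (by simp)
  have hfd : MDifferentiableAt I I' f (φ.symm y) := hf.mdifferentiable (by simp) _
  have hψ : MDifferentiableAt I' 𝓘(ℝ, E') ψ (f (φ.symm y)) :=
    mdifferentiableAt_extChartAt ((extChartAt_source I' (f x)) ▸ hfy)
  have hψf : mfderiv 𝓘(ℝ, E) 𝓘(ℝ, E') (writtenInExtChartAt I I' x f) y
      (chartField (E := E) I x V y) = mfderiv I' 𝓘(ℝ, E') ψ (f (φ.symm y))
        (mfderiv 𝓘(ℝ, E) I' (f ∘ φ.symm) y (chartField (E := E) I x V y)) :=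
    mfderiv_comp_apply y hψ (hfd.comp y hφ) _
  have hfφ : mfderiv 𝓘(ℝ, E) I' (f ∘ φ.symm) y (chartField (E := E) I x V y) =
      V' (f (φ.symm y)) := by
    refine (mfderiv_comp_apply y hfd hφ _).trans ?_
    rw [mfderiv_extChartAt_symm_chartField V hy, hVV']
  rw [mfderiv_eq_fderiv] at hψf
  refine hψf.trans ?_
  rw [hfφ]
  exact (chartField_extChartAt V' hfy).symm

theorem mfderiv_mlieBracket [CompleteSpace E] [CompleteSpace E'] (hf : ContMDiff I I' ∞ f)
    {V W : ∀ q : M, TangentSpace I q} {V' W' : ∀ q : M', TangentSpace I' q} {x : M}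
    (hV : MDifferentiableAt I I.tangent (fun q ↦ (⟨q, V q⟩ : TangentBundle I M)) x)
    (hW : MDifferentiableAt I I.tangent (fun q ↦ (⟨q, W q⟩ : TangentBundle I M)) x)
    (hV' : MDifferentiableAt I' I'.tangent (fun q ↦ (⟨q, V' q⟩ : TangentBundle I' M')) (f x))
    (hW' : MDifferentiableAt I' I'.tangent (fun q ↦ (⟨q, W' q⟩ : TangentBundle I' M')) (f x))
    (hVV' : ∀ q, mfderiv I I' f q (V q) = V' (f q))
    (hWW' : ∀ q, mfderiv I I' f q (W q) = W' (f q)) :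
    mfderiv I I' f x (mlieBracket I V W x) = mlieBracket I' V' W' (f x) := by
  set g := writtenInExtChartAt I I' x f
  have hg : ContDiffAt ℝ ∞ g (extChartAt I x x) :=
    contDiffWithinAt_univ.1 (I.range_eq_univ ▸ (contMDiffAt_iff.1 hf.contMDiffAt).2)
  have hgx : g (extChartAt I x x) = extChartAt I' (f x) (f x) := by
    simp [g, writtenInExtChartAt]
  have hdg : DifferentiableAt ℝ g (extChartAt I x x) := hg.differentiableAt (by simp)
  have hfg : mfderiv I I' f x = fderiv ℝ g (extChartAt I x x) := by
    rw [(hf.mdifferentiable (by simp) x).mfderiv, I.range_eq_univ, fderivWithin_univ]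
  have hrelV := fderiv_writtenInExtChartAt_chartField hf hVV' x
  have hrelW := fderiv_writtenInExtChartAt_chartField hf hWW' x
  have hV₀ := differentiableAt_chartField hV'
  have hW₀ := differentiableAt_chartField hW'
  rw [← hgx] at hV₀ hW₀
  have hmin : minSmoothness ℝ 2 ≤ ∞ := by
    rw [minSmoothness_of_isRCLikeNormedField]
    exact WithTop.coe_le_coe.2 le_top
  have hbracket := fderiv_apply_lieBracket hg hmin
    (differentiableAt_chartField hW) (differentiableAt_chartField hV)
  rw [mlieBracket_eq_lieBracket_chartField, mlieBracket_eq_lieBracket_chartField V' W', hfg, ← hgx]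
  rw [hrelV.fderiv_eq, hrelW.fderiv_eq, fderiv_comp _ hW₀ hdg, fderiv_comp _ hV₀ hdg]
    at hbracket
  have hVx : fderiv ℝ g (extChartAt I x x) (chartField I x V (extChartAt I x x)) =
      chartField I' (f x) V' (g (extChartAt I x x)) := hrelV.self_of_nhds
  have hWx : fderiv ℝ g (extChartAt I x x) (chartField I x W (extChartAt I x x)) =
      chartField I' (f x) W' (g (extChartAt I x x)) := hrelW.self_of_nhds
  rw [ContinuousLinearMap.comp_apply, ContinuousLinearMap.comp_apply, hVx, hWx] at hbracket
  exact hbracket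

theorem baseChange_mfderiv_cLieBracket [CompleteSpace E] [CompleteSpace E']
    (hf : ContMDiff I I' ∞ f) {Z W : ∀ q : M, CTangentSpace I q}
    {Z' W' : ∀ q : M', CTangentSpace I' q} {x : M}
    (hZ : CMDifferentiableAt I Z x) (hW : CMDifferentiableAt I W x)
    (hZ' : CMDifferentiableAt I' Z' (f x)) (hW' : CMDifferentiableAt I' W' (f x))
    (hZZ' : ∀ q, (mfderiv I I' f q).toLinearMap.baseChange ℂ (Z q) = Z' (f q))
    (hWW' : ∀ q, (mfderiv I I' f q).toLinearMap.baseChange ℂ (W q) = W' (f q)) :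
    (mfderiv I I' f x).toLinearMap.baseChange ℂ (cLieBracket I Z W x) =
      cLieBracket I' Z' W' (f x) := by
  have hre {Y : ∀ q : M, CTangentSpace I q} {Y' : ∀ q : M', CTangentSpace I' q}
      (h : ∀ q, (mfderiv I I' f q).toLinearMap.baseChange ℂ (Y q) = Y' (f q)) (q : M) :
      mfderiv I I' f q (complexRe (Y q)) = complexRe (Y' (f q)) := by
    rw [← h, complexRe_baseChange]
    rfl
  have him {Y : ∀ q : M, CTangentSpace I q} {Y' : ∀ q : M', CTangentSpace I' q}
      (h : ∀ q, (mfderiv I I' f q).toLinearMap.baseChange ℂ (Y q) = Y' (f q)) (q : M) :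
      mfderiv I I' f q (complexIm (Y q)) = complexIm (Y' (f q)) := by
    rw [← h, complexIm_baseChange]
    rfl
  apply complexTensor_ext
  · rw [complexRe_baseChange, complexRe_cLieBracket, complexRe_cLieBracket, map_sub]
    exact congrArg₂ _ (mfderiv_mlieBracket hf hZ.1 hW.1 hZ'.1 hW'.1 (hre hZZ') (hre hWW'))
      (mfderiv_mlieBracket hf hZ.2 hW.2 hZ'.2 hW'.2 (him hZZ') (him hWW'))
  · rw [complexIm_baseChange, complexIm_cLieBracket, complexIm_cLieBracket, map_add]
    exact congrArg₂ _ (mfderiv_mlieBracket hf hZ.1 hW.2 hZ'.1 hW'.2 (hre hZZ') (him hWW'))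
      (mfderiv_mlieBracket hf hZ.2 hW.1 hZ'.2 hW'.1 (him hZZ') (hre hWW'))

end Related

theorem linearIndependent_triple_map_iff {K V W : Type*} [DivisionRing K] [AddCommGroup V]
    [Module K V] [AddCommGroup W] [Module K W] {f : V →ₗ[K] W} (hf : Function.Injective f)
    {x y z : V} : LinearIndependent K ![f x, f y, f z] ↔ LinearIndependent K ![x, y, z] := by
  have hcomp : ![f x, f y, f z] = f ∘ ![x, y, z] := by
    ext i
    fin_cases i <;> rfl
  rw [hcomp, LinearMap.linearIndependent_iff f (LinearMap.ker_eq_bot.2 hf)]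

section LocalDiffeomorphism

open Topology

variable {E : Type*} [NormedAddCommGroup E] [NormedSpace ℝ E]
  {H : Type*} [TopologicalSpace H] {I : ModelWithCorners ℝ E H}
  {M : Type*} [TopologicalSpace M] [ChartedSpace H M]
  {N : Type*} [TopologicalSpace N] [ChartedSpace H N] {π : M → N}

theorem cmfderiv_complexConj (p : M) (Z : CTangentSpace I p) :
    cmfderiv I π p (complexConj Z) = complexConj (cmfderiv I π p Z) :=
  (complexConj_baseChange _ _).symm

theorem tangentBundle_mk_eq {p q : M} (h : p = q) (v : E) :
    (⟨p, v⟩ : TangentBundle I M) = ⟨q, v⟩ := by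
  rw [h]

theorem cmfderiv_injective (hπ : IsLocalDiffeomorph I I ∞ π) (p : M) :
    Function.Injective (cmfderiv I π p) := by
  refine Module.Flat.lTensor_preserves_injective_linearMap (M := ℂ)
    (mfderiv I I π p).toLinearMap ?_
  have hn : (∞ : WithTop ℕ∞) ≠ 0 := by simp
  rw [← hπ.mfderivToContinuousLinearEquiv_coe hn]
  exact (hπ.mfderivToContinuousLinearEquiv hn p).injective

variable [IsManifold I ∞ M] [IsManifold I ∞ N]

theorem contMDiff_of_isLocalDiffeomorph_of_surjective (hπ : IsLocalDiffeomorph I I ∞ π)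
    (hsurj : Function.Surjective π) {V : ∀ p : M, TangentSpace I p}
    {V' : ∀ q : N, TangentSpace I q}
    (hV : ContMDiff I I.tangent ∞ fun p ↦ (⟨p, V p⟩ : TangentBundle I M))
    (hVV' : ∀ p, mfderiv I I π p (V p) = V' (π p)) :
    ContMDiff I I.tangent ∞ fun q ↦ (⟨q, V' q⟩ : TangentBundle I N) := by
  intro q
  obtain ⟨p, rfl⟩ := hsurj q
  have hp := hπ p
  have hlift := hV.contMDiffAt.comp (π p) hp.localInverse_contMDiffAt
  have htangent := (hπ.contMDiff.contMDiff_tangentMap (m := ∞) le_rfl).contMDiffAt.comp (π p) hlift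
  refine htangent.congr_of_eventuallyEq ?_
  filter_upwards [hp.localInverse_open_source.mem_nhds hp.localInverse_mem_source] with q hq
  have hinv : π (hp.localInverse q) = q := hp.localInverse_right_inv hq
  have hVq := hVV' (hp.localInverse q)
  rw [hinv] at hVq
  refine (tangentBundle_mk_eq hinv.symm _).trans ?_
  rw [← hVq]
  rfl

theorem cSmoothOn_univ_of_isLocalDiffeomorph_of_surjective (hπ : IsLocalDiffeomorph I I ∞ π)
    (hsurj : Function.Surjective π) {Z : ∀ p : M, CTangentSpace I p}
    {Z' : ∀ q : N, CTangentSpace I q} (hZ : CSmoothOn I Z Set.univ)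
    (hZZ' : ∀ p, cmfderiv I π p (Z p) = Z' (π p)) : CSmoothOn I Z' Set.univ := by
  refine ⟨contMDiffOn_univ.2 (contMDiff_of_isLocalDiffeomorph_of_surjective hπ hsurj
      (contMDiffOn_univ.1 hZ.1) fun p ↦ ?_),
    contMDiffOn_univ.2 (contMDiff_of_isLocalDiffeomorph_of_surjective hπ hsurj
      (contMDiffOn_univ.1 hZ.2) fun p ↦ ?_)⟩
  · rw [← hZZ', cmfderiv, complexRe_baseChange]
    rfl
  · rw [← hZZ', cmfderiv, complexIm_baseChange]
    rfl

theorem exists_isImageBundle_isCRBundle_isStronglyPseudoconvex [I.Boundaryless]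
    (hE : Module.finrank ℝ E = 3) (hπ : IsLocalDiffeomorph I I ∞ π)
    (hsurj : Function.Surjective π) {Z : ∀ p : M, CTangentSpace I p}
    {Z' : ∀ q : N, CTangentSpace I q} (hZ : CSmoothOn I Z Set.univ)
    (hZZ' : ∀ p, cmfderiv I π p (Z p) = Z' (π p))
    (hframe : ∀ p, LinearIndependent ℂ
      ![cLieBracket I (fun q ↦ complexConj (Z q)) Z p, Z p, complexConj (Z p)]) :
    ∃ L : ∀ q : N, Submodule ℂ (CTangentSpace I q),
      IsImageBundle I π (fun p ↦ Submodule.span ℂ {Z p}) L ∧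
      IsCRBundle I L 1 ∧ IsStronglyPseudoconvex I L := by
  have : FiniteDimensional ℝ E := Module.finite_of_finrank_eq_succ hE
  have : CompleteSpace E := FiniteDimensional.complete ℝ E
  have hconj (p : M) : cmfderiv I π p (complexConj (Z p)) = complexConj (Z' (π p)) := by
    rw [cmfderiv_complexConj, hZZ']
  have hZ' : CSmoothOn I Z' Set.univ :=
    cSmoothOn_univ_of_isLocalDiffeomorph_of_surjective hπ hsurj hZ hZZ'
  have hbracket (p : M) : cmfderiv I π p (cLieBracket I (fun q ↦ complexConj (Z q)) Z p) =
      cLieBracket I (fun q ↦ complexConj (Z' q)) Z' (π p) := by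
    have hZp := hZ.cmdifferentiableAt (Filter.univ_mem : Set.univ ∈ 𝓝 p)
    have hZp' := hZ'.cmdifferentiableAt (Filter.univ_mem : Set.univ ∈ 𝓝 (π p))
    exact baseChange_mfderiv_cLieBracket hπ.contMDiff hZp.complexConj hZp hZp'.complexConj hZp'
      hconj hZZ'
  have hframe' (q : N) : LinearIndependent ℂ
      ![cLieBracket I (fun q ↦ complexConj (Z' q)) Z' q, Z' q, complexConj (Z' q)] := by
    obtain ⟨p, rfl⟩ := hsurj q
    rw [← hbracket, ← hconj, ← hZZ', linearIndependent_triple_map_iff (cmfderiv_injective hπ p)]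
    exact hframe p
  have hind (q : N) := (linearIndependent_finCons.1 (hframe' q)).1
  have hlevi (q : N) := (linearIndependent_finCons.1 (hframe' q)).2
  simp only [Matrix.range_cons_cons_empty] at hlevi
  refine ⟨fun q ↦ Submodule.span ℂ {Z' q}, fun p ↦ ?_, isCRBundle_span_singleton hZ' hind,
    isStronglyPseudoconvex_span_singleton hE hZ' hind hlevi⟩
  rw [Submodule.map_span, Set.image_singleton, hZZ']

end LocalDiffeomorphism

section QuotientManifold

open MulAction Topology

variable {E : Type*} [NormedAddCommGroup E] [NormedSpace ℝ E]
  {H : Type*} [TopologicalSpace H] {I : ModelWithCorners ℝ E H}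
  {M : Type*} {G : Type*} [Group G] [MulAction G M]

theorem orbitRel_mk_smul (g : G) (x : M) :
    (Quotient.mk _ (g • x) : orbitRel.Quotient G M) = Quotient.mk _ x :=
  Quotient.sound (orbitRel_apply.2 ⟨g, rfl⟩)

variable [TopologicalSpace M]

theorem eventuallyEq_smul_of_localSection [ContinuousConstSMul G M]
    {s : OpenPartialHomeomorph (orbitRel.Quotient G M) M}
    (hs : (s.symm : M → orbitRel.Quotient G M) = Quotient.mk _) {x : M}
    (hx : (Quotient.mk _ x : orbitRel.Quotient G M) ∈ s.source) :
    ∃ g : G, (fun y : M ↦ s (Quotient.mk _ y)) =ᶠ[𝓝 x] fun y ↦ g • y := by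
  have hmk : (Quotient.mk _ (s (Quotient.mk _ x)) : orbitRel.Quotient G M) = Quotient.mk _ x := by
    rw [← hs]
    exact s.left_inv (hs ▸ hx)
  obtain ⟨g, hg : g • x = s (Quotient.mk _ x)⟩ := orbitRel_apply.1 (Quotient.exact hmk)
  have htarget : s.target ∈ 𝓝 (g • x) := by
    rw [hg]
    exact s.open_target.mem_nhds (s.map_source hx)
  refine ⟨g, ?_⟩
  filter_upwards [(continuous_const_smul g).continuousAt htarget] with y hy
  rw [← orbitRel_mk_smul g y, ← hs]
  exact s.right_inv hy

variable [ChartedSpace H M]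

theorem contMDiffAt_localSection_comp_mk [ContinuousConstSMul G M]
    (hG : ∀ g : G, ContMDiff I I ∞ fun x : M ↦ g • x)
    {s : OpenPartialHomeomorph (orbitRel.Quotient G M) M}
    (hs : (s.symm : M → orbitRel.Quotient G M) = Quotient.mk _) {x : M}
    (hx : (Quotient.mk _ x : orbitRel.Quotient G M) ∈ s.source) :
    ContMDiffAt I I ∞ (fun y : M ↦ s (Quotient.mk _ y)) x := by
  obtain ⟨g, hg⟩ := eventuallyEq_smul_of_localSection hs hx
  exact (hG g).contMDiffAt.congr_of_eventuallyEq hg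

variable [ContinuousConstSMul G M] [ProperlyDiscontinuousSMul G M] [IsCancelSMul G M] [T2Space M]
  [LocallyCompactSpace M]

theorem exists_localSection_of_mem_atlas {c : OpenPartialHomeomorph (orbitRel.Quotient G M) H}
    (hc : c ∈ atlas H (orbitRel.Quotient G M)) :
    ∃ (s : OpenPartialHomeomorph (orbitRel.Quotient G M) M) (x : M),
      (s.symm : M → orbitRel.Quotient G M) = Quotient.mk _ ∧ c = s.trans (chartAt H x) := by
  obtain ⟨q, rfl⟩ := hc
  exact ⟨_, _, by simp, rfl⟩

variable [IsManifold I ∞ M]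

theorem isManifold_orbitRel_quotient (hG : ∀ g : G, ContMDiff I I ∞ fun x : M ↦ g • x) :
    IsManifold I ∞ (orbitRel.Quotient G M) := by
  refine isManifold_of_contDiffOn I ∞ _ fun c c' hc hc' ↦ ?_
  obtain ⟨s, x, hs, rfl⟩ := exists_localSection_of_mem_atlas hc
  obtain ⟨s', x', hs', rfl⟩ := exists_localSection_of_mem_atlas hc'
  rw [← contMDiffOn_iff_contDiffOn]
  set τ := (s.trans (chartAt H x)).symm.trans (s'.trans (chartAt H x'))
  have hτ : ContMDiffOn I I ∞ τ τ.source := by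
    intro y hy
    simp only [τ, mfld_simps, hs] at hy
    have hchart_symm : ContMDiffAt I I ∞ (chartAt H x).symm y :=
      contMDiffOn_chart_symm.contMDiffAt ((chartAt H x).open_target.mem_nhds hy.1.1)
    have hchart : ContMDiffAt I I ∞ (chartAt H x') (s' (Quotient.mk _ ((chartAt H x).symm y))) :=
      contMDiffOn_chart.contMDiffAt ((chartAt H x').open_source.mem_nhds hy.2.2)
    have hsection := contMDiffAt_localSection_comp_mk hG hs' hy.2.1
    refine ((hchart.comp y (hsection.comp y hchart_symm)).congr_of_eventuallyEq
      (.of_eq ?_)).contMDiffWithinAt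
    ext1 z
    simp only [τ, mfld_simps, hs]
  exact I.contMDiff.comp_contMDiffOn
    (hτ.comp (I.contMDiffOn_symm.mono Set.inter_subset_right) fun y hy ↦ hy.1)

theorem contMDiff_orbitRel_mk (hG : ∀ g : G, ContMDiff I I ∞ fun x : M ↦ g • x) :
    ContMDiff I I ∞ (Quotient.mk _ : M → orbitRel.Quotient G M) := by
  intro p
  obtain ⟨s, x, hs, hc⟩ := exists_localSection_of_mem_atlas
    (chart_mem_atlas H (Quotient.mk _ p : orbitRel.Quotient G M))
  have hp := mem_chart_source H (Quotient.mk _ p : orbitRel.Quotient G M)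
  rw [hc] at hp
  simp only [mfld_simps] at hp
  have hchart : ContMDiffAt I I ∞ (chartAt H x) (s (Quotient.mk _ p)) :=
    contMDiffOn_chart.contMDiffAt ((chartAt H x).open_source.mem_nhds hp.2)
  have hsection := contMDiffAt_localSection_comp_mk hG hs hp.1
  refine contMDiffAt_iff_target.2 ⟨continuous_quotient_mk'.continuousAt,
    (I.contMDiff.contMDiffAt.comp p (hchart.comp p hsection)).congr_of_eventuallyEq (.of_eq ?_)⟩
  ext1 z
  simp only [extChartAt, hc, mfld_simps]

theorem exists_contMDiffAt_section_orbitRel_mk [IsManifold I ∞ (orbitRel.Quotient G M)]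
    (q : orbitRel.Quotient G M) :
    ∃ σ : orbitRel.Quotient G M → M, ContMDiffAt I I ∞ σ q ∧
      ∀ᶠ r in 𝓝 q, Quotient.mk _ (σ r) = r := by
  obtain ⟨s, x, hs, hc⟩ := exists_localSection_of_mem_atlas (chart_mem_atlas H q)
  have hsource := (chartAt H q).open_source.mem_nhds (mem_chart_source H q)
  have hchart : ContMDiffAt I I ∞ (chartAt H q) q := contMDiffOn_chart.contMDiffAt hsource
  have hchart_symm : ContMDiffAt I I ∞ (chartAt H x).symm (chartAt H q q) := by
    refine contMDiffOn_chart_symm.contMDiffAt ((chartAt H x).open_target.mem_nhds ?_)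
    have hq := mem_chart_source H q
    rw [hc] at hq ⊢
    exact (chartAt H x).map_source hq.2
  refine ⟨_, hchart_symm.comp q hchart, ?_⟩
  filter_upwards [hsource] with r hr
  have hright := (chartAt H q).left_inv hr
  rw [hc] at hright ⊢
  rwa [OpenPartialHomeomorph.trans_symm_eq_symm_trans_symm, OpenPartialHomeomorph.coe_trans, hs]
    at hright

theorem contMDiffOn_localSection (hG : ∀ g : G, ContMDiff I I ∞ fun x : M ↦ g • x)
    {s : OpenPartialHomeomorph (orbitRel.Quotient G M) M}
    (hs : (s.symm : M → orbitRel.Quotient G M) = Quotient.mk _) :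
    ContMDiffOn I I ∞ s s.source := by
  have := isManifold_orbitRel_quotient (M := M) (I := I) hG
  intro q hq
  obtain ⟨σ, hσ, hmkσ⟩ := exists_contMDiffAt_section_orbitRel_mk (I := I) q
  have hsection := contMDiffAt_localSection_comp_mk hG hs (x := σ q) (by rwa [hmkσ.self_of_nhds])
  refine ((hsection.comp q hσ).congr_of_eventuallyEq ?_).contMDiffWithinAt
  filter_upwards [hmkσ] with r hr
  exact congrArg s hr.symm

theorem isLocalDiffeomorph_orbitRel_mk (hG : ∀ g : G, ContMDiff I I ∞ fun x : M ↦ g • x) :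
    IsLocalDiffeomorph I I ∞ (Quotient.mk _ : M → orbitRel.Quotient G M) := by
  intro p
  obtain ⟨e, hp, he⟩ := isQuotientCoveringMap_quotientMk_of_properlyDiscontinuousSMul
    (G := G) (E := M) |>.isCoveringMap.isLocalHomeomorph p
  refine ⟨⟨e.toPartialEquiv, e.open_source, e.open_target, ?_, ?_⟩, hp, ?_⟩
  · exact (contMDiff_orbitRel_mk hG).contMDiffOn.congr fun y _ ↦ (congrFun he y).symm
  · exact contMDiffOn_localSection hG (s := e.symm) he.symm
  · exact fun y _ ↦ congrFun he y

theorem mfderiv_orbitRel_mk_comp_mfderiv_smul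
    (hG : ∀ g : G, ContMDiff I I ∞ fun x : M ↦ g • x) (g : G) (x : M) :
    (mfderiv I I (Quotient.mk _ : M → orbitRel.Quotient G M) (g • x) ∘L
      mfderiv I I (fun y : M ↦ g • y) x : E →L[ℝ] E) =
      mfderiv I I (Quotient.mk _ : M → orbitRel.Quotient G M) x := by
  have hmk : (Quotient.mk _ : M → orbitRel.Quotient G M) ∘ (fun y ↦ g • y) = Quotient.mk _ :=
    funext (orbitRel_mk_smul g)
  have hcomp := mfderiv_comp x ((contMDiff_orbitRel_mk hG).mdifferentiable (by simp) (g • x))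
    ((hG g).mdifferentiable (by simp) x)
  let D (f : M → orbitRel.Quotient G M) : E →L[ℝ] E := mfderiv I I f x
  exact hcomp.symm.trans (congrArg D hmk)

theorem exists_cmfderiv_orbitRel_mk_eq (hG : ∀ g : G, ContMDiff I I ∞ fun x : M ↦ g • x)
    {Z : ∀ p : M, CTangentSpace I p}
    (hZ : ∀ (g : G) (p : M), cmfderiv I (fun x : M ↦ g • x) p (Z p) = Z (g • p)) :
    ∃ Z' : ∀ q : orbitRel.Quotient G M, CTangentSpace I q,
      ∀ p, cmfderiv I (Quotient.mk _) p (Z p) = Z' (Quotient.mk _ p) := by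
  let Y (p : M) : ℂ ⊗[ℝ] E :=
    cmfderiv I (Quotient.mk _ : M → orbitRel.Quotient G M) p (Z p)
  have hY (g : G) (p : M) : Y (g • p) = Y p := by
    have hcomp : Y p = cmfderiv I (Quotient.mk _ : M → orbitRel.Quotient G M) (g • p)
        (cmfderiv I (fun x : M ↦ g • x) p (Z p)) := by
      have h := congrArg (fun A : E →L[ℝ] E ↦ A.toLinearMap.baseChange ℂ (Z p))
        (mfderiv_orbitRel_mk_comp_mfderiv_smul hG g p)
      exact h.symm.trans (DFunLike.congr_fun (LinearMap.baseChange_comp ..) (Z p))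
    exact (hcomp.trans (congrArg _ (hZ g p))).symm
  refine ⟨fun q ↦ Y q.out, fun p ↦ ?_⟩
  obtain ⟨g, hg : g • p = _⟩ := orbitRel_apply.1 (Quotient.mk_out (s := orbitRel G M) p)
  exact (hY g p).symm.trans (congrArg Y hg)

end QuotientManifold

section Velocity

variable {E : Type*} [NormedAddCommGroup E] [NormedSpace ℝ E]
  {H : Type*} [TopologicalSpace H] {I : ModelWithCorners ℝ E H}
  {M : Type*} [TopologicalSpace M] [ChartedSpace H M] [IsManifold I ∞ M]

theorem contMDiff_velocity {Φ : ℝ × M → M} (hΦ : ContMDiff (𝓘(ℝ, ℝ).prod I) I ∞ Φ)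
    (hΦ₀ : ∀ x, Φ (0, x) = x) :
    ContMDiff I I.tangent ∞ (fun x ↦
      (⟨x, mfderiv 𝓘(ℝ, ℝ) I (fun t ↦ Φ (t, x)) 0 (1 : ℝ)⟩ : TangentBundle I M)) := by
  have htime : ContMDiff I 𝓘(ℝ, ℝ).tangent ∞
      (fun _ : M ↦ (⟨0, (1 : ℝ)⟩ : TangentBundle 𝓘(ℝ, ℝ) ℝ)) := contMDiff_const
  have hspace : ContMDiff I I.tangent ∞ (fun x : M ↦ (⟨x, (0 : E)⟩ : TangentBundle I M)) :=
    Bundle.contMDiff_zeroSection ℝ (TangentSpace I)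
  have hvelocity := (hΦ.contMDiff_tangentMap (m := ∞) le_rfl).comp
    (contMDiff_equivTangentBundleProd_symm.comp (htime.prodMk hspace))
  refine hvelocity.congr fun x ↦ ?_
  have hchain : mfderiv 𝓘(ℝ, ℝ) I (fun t ↦ Φ (t, x)) 0 (1 : ℝ) =
      mfderiv (𝓘(ℝ, ℝ).prod I) I Φ (0, x) ((1 : ℝ), (0 : E)) :=
    (mfderiv_comp_apply (I := 𝓘(ℝ, ℝ)) (f := fun t : ℝ ↦ (t, x)) (0 : ℝ)
      (hΦ.mdifferentiable (by simp) (0, x))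
      (mdifferentiableAt_id.prodMk mdifferentiableAt_const) (1 : ℝ)).trans
      (congrArg (mfderiv (𝓘(ℝ, ℝ).prod I) I Φ (0, x))
        (DFunLike.congr_fun (mfderiv_prod_left (I := 𝓘(ℝ, ℝ)) (I' := I)) (1 : ℝ)))
  refine (tangentBundle_mk_eq (hΦ₀ x).symm _).trans ?_
  rw [hchain]
  rfl

end Velocity

section Sphere

variable {F : Type*} [NormedAddCommGroup F] [InnerProductSpace ℝ F]

theorem add_smul_ne_zero_of_inner_eq_zero {z v : F} (hz : z ≠ 0) (hzv : inner ℝ z v = 0) (t : ℝ) :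
    z + t • v ≠ 0 := by
  intro h
  have hinner : inner ℝ z (z + t • v) = inner ℝ z z := by
    rw [inner_add_right, inner_smul_right, hzv, mul_zero, add_zero]
  rw [h, inner_zero_right] at hinner
  exact hz (inner_self_eq_zero.1 hinner.symm)

theorem hasDerivAt_inv_norm_smul_add_smul {z v : F} (hz : ‖z‖ = 1) (hzv : inner ℝ z v = 0) :
    HasDerivAt (fun t : ℝ ↦ ‖z + t • v‖⁻¹ • (z + t • v)) v 0 := by
  have hline : HasDerivAt (fun t : ℝ ↦ z + t • v) v 0 := by
    simpa using ((hasDerivAt_id (0 : ℝ)).smul_const v).const_add z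
  have hnorm : HasDerivAt (fun t : ℝ ↦ ‖z + t • v‖) 0 0 := by
    simpa [hz, hzv] using hline.norm_sq.sqrt (by simp [hz])
  exact ((hnorm.inv (by simp [hz])).smul hline).congr_deriv (by simp [hz])

variable {n : ℕ} [Fact (Module.finrank ℝ F = n + 1)]

theorem exists_contMDiff_mvfderiv_subtypeVal_sphere_eq {v : F → F} (hv : ContDiff ℝ ∞ v)
    (hinner : ∀ z ∈ Metric.sphere (0 : F) 1, inner ℝ z (v z) = 0) :
    ∃ X : ∀ z : Metric.sphere (0 : F) 1, TangentSpace (𝓡 n) z,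
      ContMDiff (𝓡 n) (𝓡 n).tangent ∞
        (fun z ↦ (⟨z, X z⟩ : TangentBundle (𝓡 n) (Metric.sphere (0 : F) 1))) ∧
      ∀ z, mvfderiv (𝓡 n) (Subtype.val : Metric.sphere (0 : F) 1 → F) z (X z) = v z := by
  have hne (p : ℝ × Metric.sphere (0 : F) 1) : p.2.1 + p.1 • v p.2 ≠ 0 :=
    add_smul_ne_zero_of_inner_eq_zero (ne_zero_of_mem_unit_sphere p.2) (hinner _ p.2.2) _
  have hmem (p : ℝ × Metric.sphere (0 : F) 1) :
      ‖p.2.1 + p.1 • v p.2‖⁻¹ • (p.2.1 + p.1 • v p.2) ∈ Metric.sphere (0 : F) 1 :=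
    mem_sphere_zero_iff_norm.2 (norm_smul_inv_norm (𝕜 := ℝ) (hne p))
  let Φ : ℝ × Metric.sphere (0 : F) 1 → Metric.sphere (0 : F) 1 := Set.codRestrict _ _ hmem
  have hΦ : ContMDiff (𝓘(ℝ, ℝ).prod (𝓡 n)) (𝓡 n) ∞ Φ := by
    apply ContMDiff.codRestrict_sphere
    have hz : ContMDiff (𝓘(ℝ, ℝ).prod (𝓡 n)) 𝓘(ℝ, F) ∞
        fun p : ℝ × Metric.sphere (0 : F) 1 ↦ p.2.1 := contMDiff_coe_sphere.comp contMDiff_snd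
    have hline : ContMDiff (𝓘(ℝ, ℝ).prod (𝓡 n)) 𝓘(ℝ, F) ∞
        fun p : ℝ × Metric.sphere (0 : F) 1 ↦ p.2.1 + p.1 • v p.2 :=
      hz.add (contMDiff_fst.smul (hv.contMDiff.comp hz))
    have hnorm : ContMDiff (𝓘(ℝ, ℝ).prod (𝓡 n)) 𝓘(ℝ, ℝ) ∞
        fun p : ℝ × Metric.sphere (0 : F) 1 ↦ ‖p.2.1 + p.1 • v p.2‖⁻¹ := fun p ↦
      ContDiffAt.comp_contMDiffAt (g := fun w : F ↦ ‖w‖⁻¹)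
        ((contDiffAt_norm ℝ (hne p)).inv (norm_ne_zero_iff.2 (hne p))) hline.contMDiffAt
    exact hnorm.smul hline
  have hΦ₀ (z : Metric.sphere (0 : F) 1) : Φ (0, z) = z := by
    ext1
    simp [Φ]
  refine ⟨_, contMDiff_velocity hΦ hΦ₀, fun z ↦ ?_⟩
  have hcurve : MDifferentiableAt 𝓘(ℝ, ℝ) (𝓡 n) (fun t ↦ Φ (t, z)) 0 :=
    (hΦ.mdifferentiable (by simp) (0, z)).comp (0 : ℝ)
      (mdifferentiableAt_id.prodMk mdifferentiableAt_const)
  have hchain := mfderiv_comp_apply_of_eq (0 : ℝ)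
    (contMDiff_coe_sphere.mdifferentiable (n := 1) one_ne_zero z) hcurve (hΦ₀ z) (1 : ℝ)
  rw [mfderiv_eq_fderiv] at hchain
  have hderiv : HasDerivAt (Subtype.val ∘ fun t ↦ Φ (t, z)) (v z) 0 :=
    hasDerivAt_inv_norm_smul_add_smul (by simp) (hinner z z.2)
  rw [hderiv.hasFDerivAt.fderiv] at hchain
  exact hchain.symm.trans (one_smul ℝ (v z))

theorem exists_cSmoothOn_baseChange_mfderiv_subtypeVal_sphere_eq {A : F → ℂ ⊗[ℝ] F}
    (hre : ContDiff ℝ ∞ fun z ↦ complexRe (A z)) (him : ContDiff ℝ ∞ fun z ↦ complexIm (A z))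
    (hA : ∀ z ∈ Metric.sphere (0 : F) 1, complexFunctional (innerₗ F z) (A z) = 0) :
    ∃ Z : ∀ z : Metric.sphere (0 : F) 1, CTangentSpace (𝓡 n) z, CSmoothOn (𝓡 n) Z Set.univ ∧
      ∀ z, (mvfderiv (𝓡 n) (Subtype.val : Metric.sphere (0 : F) 1 → F) z).toLinearMap.baseChange ℂ
        (Z z) = A z := by
  have hinner (z) (hz : z ∈ Metric.sphere (0 : F) 1) :
      inner ℝ z (complexRe (A z)) = 0 ∧ inner ℝ z (complexIm (A z)) = 0 := by
    simpa [complexFunctional_eq, Complex.ext_iff] using hA z hz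
  obtain ⟨X, hX, hιX⟩ := exists_contMDiff_mvfderiv_subtypeVal_sphere_eq (n := n) hre
    fun z hz ↦ (hinner z hz).1
  obtain ⟨Y, hY, hιY⟩ := exists_contMDiff_mvfderiv_subtypeVal_sphere_eq (n := n) him
    fun z hz ↦ (hinner z hz).2
  refine ⟨fun z ↦ (1 : ℂ) ⊗ₜ[ℝ] X z + Complex.I ⊗ₜ[ℝ] Y z,
    ⟨by simpa using hX.contMDiffOn, by simpa using hY.contMDiffOn⟩, fun z ↦ ?_⟩
  apply complexTensor_ext <;> simp [hιX, hιY]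

end Sphere

section LinearFields

theorem liftBaseChange_eq_add_smul {V W : Type*} [AddCommGroup V] [Module ℝ V] [AddCommGroup W]
    [Module ℝ W] [Module ℂ W] [IsScalarTower ℝ ℂ W] (A : V →ₗ[ℝ] W) (x : ℂ ⊗[ℝ] V) :
    A.liftBaseChange ℂ x = A (complexRe x) + Complex.I • A (complexIm x) := by
  conv_lhs => rw [← complexRe_add_I_complexIm x]
  simp

variable {F : Type*} [NormedAddCommGroup F] [NormedSpace ℝ F]

/-- The complex vector field on the vector space `F` with value `A z` at `z`, under the
identification of `ℂ ⊗ T_z F` with `ℂ ⊗ F`. -/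
def linearField (A : F →ₗ[ℝ] ℂ ⊗[ℝ] F) (z : F) : CTangentSpace 𝓘(ℝ, F) z := A z

variable [FiniteDimensional ℝ F]

theorem mlieBracket_linearMap (A B : F →ₗ[ℝ] F) (z : F) :
    VectorField.mlieBracket 𝓘(ℝ, F) (M := F) A B z = B (A z) - A (B z) := by
  have hfderiv (C : F →ₗ[ℝ] F) : fderiv ℝ C z = C.toContinuousLinearMap :=
    C.toContinuousLinearMap.fderiv
  have hbracket : VectorField.lieBracketWithin ℝ A B Set.univ z = B (A z) - A (B z) := by
    simp [VectorField.lieBracketWithin_univ, VectorField.lieBracket, hfderiv]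
  have hmlie (V W : ∀ w : F, TangentSpace 𝓘(ℝ, F) w) :
      VectorField.mlieBracket 𝓘(ℝ, F) V W z = VectorField.lieBracketWithin ℝ V W Set.univ z := by
    rw [← VectorField.mlieBracketWithin_univ, VectorField.mlieBracketWithin_eq_lieBracketWithin]
  exact (hmlie A B).trans hbracket

theorem cLieBracket_linearField (A B : F →ₗ[ℝ] ℂ ⊗[ℝ] F) (z : F) :
    cLieBracket 𝓘(ℝ, F) (linearField A) (linearField B) z =
      linearField ((B.liftBaseChange ℂ).restrictScalars ℝ ∘ₗ A -
        (A.liftBaseChange ℂ).restrictScalars ℝ ∘ₗ B) z := by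
  have hre (C D : F →ₗ[ℝ] ℂ ⊗[ℝ] F) : complexRe (C.liftBaseChange ℂ (D z)) =
      complexRe (C (complexRe (D z))) - complexIm (C (complexIm (D z))) := by
    simp [liftBaseChange_eq_add_smul, complexRe_smul, sub_eq_add_neg]
  have him (C D : F →ₗ[ℝ] ℂ ⊗[ℝ] F) : complexIm (C.liftBaseChange ℂ (D z)) =
      complexIm (C (complexRe (D z))) + complexRe (C (complexIm (D z))) := by
    simp [liftBaseChange_eq_add_smul, complexIm_smul]
  apply complexTensor_ext
  · refine (complexRe_cLieBracket _ _ z).trans ?_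
    refine (congrArg₂ (· - ·) (mlieBracket_linearMap (complexRe ∘ₗ A) (complexRe ∘ₗ B) z)
      (mlieBracket_linearMap (complexIm ∘ₗ A) (complexIm ∘ₗ B) z)).trans ?_
    have : complexRe (B.liftBaseChange ℂ (A z) - A.liftBaseChange ℂ (B z)) = _ :=
      (map_sub _ _ _).trans (congrArg₂ (· - ·) (hre B A) (hre A B))
    refine Eq.trans ?_ this.symm
    simp only [LinearMap.coe_comp, Function.comp_apply]
    abel
  · refine (complexIm_cLieBracket _ _ z).trans ?_
    refine (congrArg₂ (· + ·) (mlieBracket_linearMap (complexRe ∘ₗ A) (complexIm ∘ₗ B) z)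
      (mlieBracket_linearMap (complexIm ∘ₗ A) (complexRe ∘ₗ B) z)).trans ?_
    have : complexIm (B.liftBaseChange ℂ (A z) - A.liftBaseChange ℂ (B z)) = _ :=
      (map_sub _ _ _).trans (congrArg₂ (· - ·) (him B A) (him A B))
    refine Eq.trans ?_ this.symm
    simp only [LinearMap.coe_comp, Function.comp_apply]
    abel

theorem cmdifferentiableAt_linearField (A : F →ₗ[ℝ] ℂ ⊗[ℝ] F) (z : F) :
    CMDifferentiableAt 𝓘(ℝ, F) (linearField A) z := by
  have hsmooth (C : F →ₗ[ℝ] F) : MDifferentiableAt 𝓘(ℝ, F) 𝓘(ℝ, F).tangent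
      (fun w ↦ (⟨w, C w⟩ : TangentBundle 𝓘(ℝ, F) F)) z :=
    (contMDiffAt_vectorSpace_iff_contDiffAt.2
      C.toContinuousLinearMap.contDiff.contDiffAt).mdifferentiableAt one_ne_zero
  exact ⟨hsmooth (complexRe ∘ₗ A), hsmooth (complexIm ∘ₗ A)⟩

end LinearFields

section ComplexCoordinates

/-- The coordinate `dz_j` on the complexified tangent spaces of `ℂ²`. -/
def dzCoord (j : Fin 2) : ℂ ⊗[ℝ] C2 →ₗ[ℂ] ℂ :=
  ((EuclideanSpace.proj j : C2 →L[ℂ] ℂ).toLinearMap.restrictScalars ℝ).liftBaseChange ℂ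

/-- The coordinate `d(conj z_j)` on the complexified tangent spaces of `ℂ²`. -/
def dzbarCoord (j : Fin 2) : ℂ ⊗[ℝ] C2 →ₗ[ℂ] ℂ :=
  (Complex.conjAe.toLinearMap ∘ₗ
    (EuclideanSpace.proj j : C2 →L[ℂ] ℂ).toLinearMap.restrictScalars ℝ).liftBaseChange ℂ

@[simp]
theorem dzCoord_tmul (j : Fin 2) (a : ℂ) (v : C2) : dzCoord j (a ⊗ₜ v) = a * v j := by
  simp [dzCoord]

@[simp]
theorem dzbarCoord_tmul (j : Fin 2) (a : ℂ) (v : C2) :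
    dzbarCoord j (a ⊗ₜ v) = a * conj (v j) := by
  simp [dzbarCoord]

@[simp]
theorem dzCoord_dz (j k : Fin 2) : dzCoord j (dz k) = if j = k then 1 else 0 := by
  rcases eq_or_ne j k with rfl | h
  · norm_num [dz]
  · simp [dz, h]

@[simp]
theorem dzCoord_dzbar (j k : Fin 2) : dzCoord j (dzbar k) = 0 := by
  by_cases h : j = k <;> simp [dzbar, h]

@[simp]
theorem dzbarCoord_dz (j k : Fin 2) : dzbarCoord j (dz k) = 0 := by
  by_cases h : j = k <;> simp [dz, h]

@[simp]
theorem dzbarCoord_dzbar (j k : Fin 2) : dzbarCoord j (dzbar k) = if j = k then 1 else 0 := by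
  rcases eq_or_ne j k with rfl | h
  · norm_num [dzbar]
  · simp [dzbar, h]

theorem complexConj_dz (j : Fin 2) : complexConj (dz j) = dzbar j := by
  apply complexTensor_ext <;> simp [dz, dzbar, complexRe_smul, complexIm_smul]

theorem complexConj_dzbar (j : Fin 2) : complexConj (dzbar j) = dz j := by
  apply complexTensor_ext <;> simp [dz, dzbar, complexRe_smul, complexIm_smul]

theorem dzCoord_eq (j : Fin 2) (x : ℂ ⊗[ℝ] C2) :
    dzCoord j x = complexRe x j + Complex.I * complexIm x j := by
  conv_lhs => rw [← complexRe_add_I_complexIm x]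
  simp

theorem dzbarCoord_eq (j : Fin 2) (x : ℂ ⊗[ℝ] C2) :
    dzbarCoord j x = conj (complexRe x j) + Complex.I * conj (complexIm x j) := by
  conv_lhs => rw [← complexRe_add_I_complexIm x]
  simp

theorem ext_dzCoord_dzbarCoord {x y : ℂ ⊗[ℝ] C2} (hdz : ∀ j, dzCoord j x = dzCoord j y)
    (hdzbar : ∀ j, dzbarCoord j x = dzbarCoord j y) : x = y := by
  simp only [dzCoord_eq] at hdz
  have hconj (j : Fin 2) : complexRe x j - Complex.I * complexIm x j =
      complexRe y j - Complex.I * complexIm y j := by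
    simpa [dzbarCoord_eq, ← sub_eq_add_neg] using congrArg conj (hdzbar j)
  apply complexTensor_ext <;> ext j
  · linear_combination (hdz j + hconj j) / 2
  · linear_combination -Complex.I / 2 * (hdz j - hconj j) -
      (complexIm y j - complexIm x j) * Complex.I_sq

theorem dzCoord_baseChange_toEuclideanLin (A : Matrix (Fin 2) (Fin 2) ℂ) (j : Fin 2)
    (x : ℂ ⊗[ℝ] C2) :
    dzCoord j (((Matrix.toEuclideanLin A).restrictScalars ℝ).baseChange ℂ x) =
      ∑ k, A j k * dzCoord k x := by
  induction x using TensorProduct.induction_on with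
  | zero => simp
  | tmul a v => simp [Matrix.mulVec, dotProduct, mul_add, mul_left_comm]
  | add x y hx hy => simp only [map_add, hx, hy, mul_add, Finset.sum_add_distrib]

theorem dzbarCoord_baseChange_toEuclideanLin (A : Matrix (Fin 2) (Fin 2) ℂ) (j : Fin 2)
    (x : ℂ ⊗[ℝ] C2) :
    dzbarCoord j (((Matrix.toEuclideanLin A).restrictScalars ℝ).baseChange ℂ x) =
      ∑ k, conj (A j k) * dzbarCoord k x := by
  induction x using TensorProduct.induction_on with
  | zero => simp
  | tmul a v => simp [Matrix.mulVec, dotProduct, mul_add, mul_left_comm]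
  | add x y hx hy => simp only [map_add, hx, hy, mul_add, Finset.sum_add_distrib]

theorem complexFunctional_innerₗ_eq (z : C2) (x : ℂ ⊗[ℝ] C2) :
    complexFunctional (innerₗ C2 z) x =
      (1 / 2 : ℂ) * ∑ j, (conj (z j) * dzCoord j x + z j * dzbarCoord j x) := by
  induction x using TensorProduct.induction_on with
  | zero => simp
  | tmul a v =>
    simp only [complexFunctional, LinearMap.liftBaseChange_tmul, LinearMap.comp_apply,
      ContinuousLinearMap.coe_coe, Complex.ofRealCLM_apply, innerₗ_apply_apply, PiLp.inner_apply,
      Complex.inner, Complex.ofReal_add, Complex.re_eq_add_conj, map_mul, Complex.conj_conj,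
      dzCoord_tmul, dzbarCoord_tmul, smul_eq_mul, Fin.sum_univ_two]
    ring
  | add x y hx hy => simp only [map_add, hx, hy, mul_add, Finset.sum_add_distrib]; ring

end ComplexCoordinates

section RossiField

/-- The complex vector field `a ℒ + b conj ℒ` on `ℂ²`, encoded as a real-linear map so that Lie
brackets of such fields are computed by linear algebra. -/
def crCombination (a b : ℂ) : C2 →ₗ[ℝ] ℂ ⊗[ℝ] C2 where
  toFun z := a • crField z + b • crFieldBar z
  map_add' z w := by
    simp only [crField, crFieldBar, PiLp.add_apply, map_add]
    module
  map_smul' r z := by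
    simp only [crField, crFieldBar, PiLp.smul_apply, Complex.real_smul, map_mul,
      Complex.conj_ofReal, RingHom.id_apply]
    rw [← algebraMap_smul ℂ r, Complex.coe_algebraMap]
    module

/-- The rotation field `∑ z_j ∂/∂z_j - conj z_j ∂/∂(conj z_j)` on `ℂ²`, which is `-i` times the
velocity of `θ ↦ exp(iθ) z`. -/
def rotationField (z : C2) : ℂ ⊗[ℝ] C2 := ∑ j, (z j • dz j - conj (z j) • dzbar j)

theorem crCombination_apply (a b : ℂ) (z : C2) :
    crCombination a b z = a • crField z + b • crFieldBar z := rfl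

theorem rossiField_eq_crCombination (t : ℂ) (z : C2) :
    rossiField t z = crCombination 1 (conj t) z := by
  simp [rossiField, crCombination_apply]

theorem complexConj_crCombination (a b : ℂ) (z : C2) :
    complexConj (crCombination a b z) = crCombination (conj b) (conj a) z := by
  simp [crCombination_apply, crField, crFieldBar, complexConj_smul, complexConj_dz,
    complexConj_dzbar, add_comm]

theorem smul_crCombination_add_smul_crCombination (r s a b c d : ℂ) (z : C2) :
    r • crCombination a b z + s • crCombination c d z =
      crCombination (r * a + s * c) (r * b + s * d) z := by
  simp only [crCombination_apply]
  module

theorem dzCoord_crCombination (a b : ℂ) (z : C2) (j : Fin 2) :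
    dzCoord j (crCombination a b z) = a * ![-conj (z 1), conj (z 0)] j := by
  fin_cases j <;> simp [crCombination_apply, crField, crFieldBar]

theorem dzbarCoord_crCombination (a b : ℂ) (z : C2) (j : Fin 2) :
    dzbarCoord j (crCombination a b z) = b * ![-z 1, z 0] j := by
  fin_cases j <;> simp [crCombination_apply, crField, crFieldBar]

theorem dzCoord_rotationField (z : C2) (j : Fin 2) : dzCoord j (rotationField z) = z j := by
  fin_cases j <;> simp [rotationField]

theorem dzbarCoord_rotationField (z : C2) (j : Fin 2) :
    dzbarCoord j (rotationField z) = -conj (z j) := by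
  fin_cases j <;> simp [rotationField]

theorem complexFunctional_innerₗ_crCombination (a b : ℂ) (z : C2) :
    complexFunctional (innerₗ C2 z) (crCombination a b z) = 0 := by
  simp only [complexFunctional_innerₗ_eq, dzCoord_crCombination, dzbarCoord_crCombination,
    Fin.sum_univ_two, Matrix.cons_val]
  ring

theorem crCombination_add_smul_rotationField_eq_zero_iff {a b c : ℂ} (z : S3) :
    crCombination a b z.1 + c • rotationField z.1 = 0 ↔ a = 0 ∧ b = 0 ∧ c = 0 := by
  refine ⟨fun h ↦ ?_, ?_⟩
  · have hnorm := S3.normSq_add z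
    have hdz (j : Fin 2) : a * ![-conj (z.1 1), conj (z.1 0)] j + c * z.1 j = 0 := by
      simpa [dzCoord_crCombination, dzCoord_rotationField] using congrArg (dzCoord j) h
    have hdzbar (j : Fin 2) : b * ![-z.1 1, z.1 0] j + c * -conj (z.1 j) = 0 := by
      simpa [dzbarCoord_crCombination, dzbarCoord_rotationField] using congrArg (dzbarCoord j) h
    simp only [Fin.forall_fin_two, Matrix.cons_val] at hdz hdzbar
    refine ⟨?_, ?_, ?_⟩
    · linear_combination -a * hnorm - z.1 1 * hdz.1 + z.1 0 * hdz.2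
    · linear_combination -b * hnorm - conj (z.1 1) * hdzbar.1 + conj (z.1 0) * hdzbar.2
    · linear_combination -c * hnorm + conj (z.1 0) * hdz.1 + conj (z.1 1) * hdz.2
  · rintro ⟨rfl, rfl, rfl⟩
    simp [crCombination_apply]

theorem baseChange_toEuclideanLin_crCombination (a b : ℂ) (g : SU2) (z : C2) :
    ((Matrix.toEuclideanLin g.1).restrictScalars ℝ).baseChange ℂ (crCombination a b z) =
      crCombination a b (Matrix.toEuclideanLin g.1 z) := by
  obtain ⟨w, rfl⟩ := sphereEquivSU2.surjective g
  apply ext_dzCoord_dzbarCoord <;> intro j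
  · rw [dzCoord_baseChange_toEuclideanLin]
    simp only [dzCoord_crCombination]
    fin_cases j <;>
    · simp only [sphereEquivSU2, Equiv.coe_fn_mk, Matrix.of_apply, Matrix.cons_val, Fin.zero_eta,
        Fin.mk_one, Fin.sum_univ_two, Matrix.ofLp_toLpLin, Matrix.toLin'_apply, Matrix.mulVec,
        dotProduct, map_add, map_mul, map_neg, Complex.conj_conj]
      ring
  · rw [dzbarCoord_baseChange_toEuclideanLin]
    simp only [dzbarCoord_crCombination]
    fin_cases j <;>
    · simp only [sphereEquivSU2, Equiv.coe_fn_mk, Matrix.of_apply, Matrix.cons_val, Fin.zero_eta,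
        Fin.mk_one, Fin.sum_univ_two, Matrix.ofLp_toLpLin, Matrix.toLin'_apply, Matrix.mulVec,
        dotProduct, map_neg, Complex.conj_conj]
      ring

theorem liftBaseChange_crCombination (a b : ℂ) (x : ℂ ⊗[ℝ] C2) :
    (crCombination a b).liftBaseChange ℂ x =
      a • (dzbarCoord 0 x • dz 1 - dzbarCoord 1 x • dz 0) +
        b • (dzCoord 0 x • dzbar 1 - dzCoord 1 x • dzbar 0) := by
  induction x using TensorProduct.induction_on with
  | zero => simp
  | tmul c v =>
    simp only [LinearMap.liftBaseChange_tmul, crCombination_apply, crField, crFieldBar,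
      dzCoord_tmul, dzbarCoord_tmul]
    module
  | add x y hx hy =>
    simp only [map_add, hx, hy]
    module

theorem liftBaseChange_crCombination_sub (a b c d : ℂ) (z : C2) :
    (crCombination c d).liftBaseChange ℂ (crCombination a b z) -
      (crCombination a b).liftBaseChange ℂ (crCombination c d z) =
    (a * d - b * c) • rotationField z := by
  simp only [liftBaseChange_crCombination, dzCoord_crCombination, dzbarCoord_crCombination,
    rotationField, Fin.sum_univ_two, Matrix.cons_val]
  module

theorem cLieBracket_crCombination (a b c d : ℂ) (z : C2) :
    cLieBracket 𝓘(ℝ, C2) (linearField (crCombination a b)) (linearField (crCombination c d)) z =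
      (a * d - b * c) • rotationField z :=
  (cLieBracket_linearField _ _ z).trans (liftBaseChange_crCombination_sub a b c d z)

theorem linearIndependent_rotationField_crCombination {a b c d : ℂ} (h : c * b - d * a ≠ 0)
    (z : S3) : LinearIndependent ℂ
      ![(c * b - d * a) • rotationField z.1, crCombination a b z.1, crCombination c d z.1] := by
  refine Fintype.linearIndependent_iff.2 fun s hs ↦ ?_
  rw [Fin.sum_univ_three] at hs
  simp only [Matrix.cons_val] at hs
  rw [smul_smul, add_assoc, smul_crCombination_add_smul_crCombination, add_comm,
    crCombination_add_smul_rotationField_eq_zero_iff] at hs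
  obtain ⟨h1, h2, h0⟩ := hs
  have hs0 : s 0 = 0 := (mul_eq_zero_iff_right h).1 h0
  have hs1 : s 1 = 0 := (mul_eq_zero_iff_right h).1 (by linear_combination c * h2 - d * h1)
  have hs2 : s 2 = 0 := (mul_eq_zero_iff_right h).1 (by linear_combination b * h1 - a * h2)
  intro i
  fin_cases i
  exacts [hs0, hs1, hs2]

end RossiField

section RossiSphere

theorem sphereInclDeriv_injective (z : S3) : Function.Injective (sphereInclDeriv z) :=
  Module.Flat.lTensor_preserves_injective_linearMap _ (injective_mvfderiv_subtypeVal_sphere z)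

theorem sphereInclDeriv_complexConj (z : S3) (x : CTangentSpace (𝓡 3) z) :
    sphereInclDeriv z (complexConj x) = complexConj (sphereInclDeriv z x) :=
  (complexConj_baseChange _ _).symm

theorem sphereInclDeriv_cLieBracket {Z W : ∀ z : S3, CTangentSpace (𝓡 3) z} {z : S3}
    (hZ : CMDifferentiableAt (𝓡 3) Z z) (hW : CMDifferentiableAt (𝓡 3) W z)
    {A B : C2 →ₗ[ℝ] ℂ ⊗[ℝ] C2} (hA : ∀ w, sphereInclDeriv w (Z w) = A w)
    (hB : ∀ w, sphereInclDeriv w (W w) = B w) :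
    sphereInclDeriv z (cLieBracket (𝓡 3) Z W z) =
      cLieBracket 𝓘(ℝ, C2) (linearField A) (linearField B) z.1 :=
  baseChange_mfderiv_cLieBracket contMDiff_coe_sphere hZ hW
    (cmdifferentiableAt_linearField A z.1) (cmdifferentiableAt_linearField B z.1) hA hB

theorem exists_cSmoothOn_sphereInclDeriv_eq_rossiField (t : ℂ) :
    ∃ Z : ∀ z : S3, CTangentSpace (𝓡 3) z, CSmoothOn (𝓡 3) Z Set.univ ∧
      ∀ z, sphereInclDeriv z (Z z) = rossiField t z := by
  have hsmooth (A : C2 →ₗ[ℝ] C2) : ContDiff ℝ ∞ A := A.toContinuousLinearMap.contDiff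
  obtain ⟨Z, hZ, hZA⟩ := exists_cSmoothOn_baseChange_mfderiv_subtypeVal_sphere_eq (n := 3)
    (hsmooth (complexRe ∘ₗ crCombination 1 (conj t)))
    (hsmooth (complexIm ∘ₗ crCombination 1 (conj t)))
    fun z _ ↦ complexFunctional_innerₗ_crCombination 1 (conj t) z
  exact ⟨Z, hZ, fun z ↦ (hZA z).trans (rossiField_eq_crCombination t z).symm⟩

theorem linearIndependent_of_sphereInclDeriv_eq_rossiField {t : ℂ} (ht : ‖t‖ ≠ 1)
    {Z : ∀ z : S3, CTangentSpace (𝓡 3) z} (hZ : CSmoothOn (𝓡 3) Z Set.univ)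
    (hZt : ∀ z, sphereInclDeriv z (Z z) = rossiField t z) (z : S3) :
    LinearIndependent ℂ
      ![cLieBracket (𝓡 3) (fun w ↦ complexConj (Z w)) Z z, Z z, complexConj (Z z)] := by
  have hdet : t * conj t - 1 * 1 ≠ 0 := by
    rw [Complex.mul_conj', one_mul, sub_ne_zero]
    exact_mod_cast (pow_eq_one_iff_of_nonneg (norm_nonneg t) two_ne_zero).not.2 ht
  have hZz : CMDifferentiableAt (𝓡 3) Z z := hZ.cmdifferentiableAt Filter.univ_mem
  have hZ_eq (w : S3) : sphereInclDeriv w (Z w) = crCombination 1 (conj t) w := by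
    rw [hZt, rossiField_eq_crCombination]
  have hconj_eq (w : S3) : sphereInclDeriv w (complexConj (Z w)) = crCombination t 1 w := by
    rw [sphereInclDeriv_complexConj, hZ_eq, complexConj_crCombination, map_one, Complex.conj_conj]
  rw [← linearIndependent_triple_map_iff (sphereInclDeriv_injective z), hZ_eq, hconj_eq,
    sphereInclDeriv_cLieBracket hZz.complexConj hZz hconj_eq hZ_eq, cLieBracket_crCombination]
  exact linearIndependent_rotationField_crCombination hdet z

theorem rossiBundle_eq_span_singleton {t : ℂ} {z : S3} {x : CTangentSpace (𝓡 3) z}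
    (hx : sphereInclDeriv z x = rossiField t z) : rossiBundle t z = Submodule.span ℂ {x} := by
  rw [rossiBundle, ← hx, ← Set.image_singleton, ← Submodule.map_span,
    Submodule.comap_map_eq_of_injective (sphereInclDeriv_injective z)]

theorem standardBundle_eq_rossiBundle_zero : standardBundle = rossiBundle 0 := by
  ext1 z
  simp [standardBundle, rossiBundle, rossiField]

theorem sphere_smul_coe_eq_toEuclideanLin (g : SU2) (z : S3) :
    (g • z).1 = Matrix.toEuclideanLin g.1 z.1 :=
  sphere_smul_coe g z

theorem hasFDerivAt_toEuclideanLin (A : Matrix (Fin 2) (Fin 2) ℂ) (z : C2) :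
    HasFDerivAt (Matrix.toEuclideanLin A)
      ((Matrix.toEuclideanLin A).restrictScalars ℝ).toContinuousLinearMap z :=
  ((Matrix.toEuclideanLin A).restrictScalars ℝ).toContinuousLinearMap.hasFDerivAt

theorem contMDiff_sphere_smul (g : SU2) : ContMDiff (𝓡 3) (𝓡 3) ∞ fun z : S3 ↦ g • z := by
  have hlin : ContDiff ℝ ∞ (Matrix.toEuclideanLin g.1) :=
    ((Matrix.toEuclideanLin g.1).restrictScalars ℝ).toContinuousLinearMap.contDiff
  have hval : ContMDiff (𝓡 3) 𝓘(ℝ, C2) ∞ fun z : S3 ↦ (g • z).1 := by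
    simp only [sphere_smul_coe_eq_toEuclideanLin]
    exact hlin.contMDiff.comp contMDiff_coe_sphere
  exact hval.codRestrict_sphere fun z ↦ (g • z).2

theorem mvfderiv_subtypeVal_comp_mfderiv_smul (g : SU2) (z : S3) :
    (mvfderiv (𝓡 3) (Subtype.val : S3 → C2) (g • z)).toLinearMap ∘ₗ
        (mfderiv (𝓡 3) (𝓡 3) (fun w : S3 ↦ g • w) z).toLinearMap =
      (Matrix.toEuclideanLin g.1).restrictScalars ℝ ∘ₗ
        (mvfderiv (𝓡 3) (Subtype.val : S3 → C2) z).toLinearMap := by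
  have hval (w : S3) : HasMFDerivAt (𝓡 3) 𝓘(ℝ, C2) (Subtype.val : S3 → C2) w
      (mvfderiv (𝓡 3) Subtype.val w) :=
    (contMDiff_coe_sphere.mdifferentiableAt one_ne_zero).hasMFDerivAt
  have hsmul := ((contMDiff_sphere_smul g).mdifferentiableAt (by simp) (x := z)).hasMFDerivAt
  have hval_smul := (hval (g • z)).comp z hsmul
  have hlin_val := (hasFDerivAt_toEuclideanLin g.1 z.1).hasMFDerivAt.comp z (hval z)
  have hfun : Subtype.val ∘ (fun w : S3 ↦ g • w) = Matrix.toEuclideanLin g.1 ∘ Subtype.val :=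
    funext (sphere_smul_coe_eq_toEuclideanLin g)
  rw [hfun] at hval_smul
  exact congrArg ContinuousLinearMap.toLinearMap (hasMFDerivAt_unique hval_smul hlin_val)

theorem sphereInclDeriv_cmfderiv_smul (g : SU2) (z : S3) (x : CTangentSpace (𝓡 3) z) :
    sphereInclDeriv (g • z) (cmfderiv (𝓡 3) (fun w ↦ g • w) z x) =
      ((Matrix.toEuclideanLin g.1).restrictScalars ℝ).baseChange ℂ (sphereInclDeriv z x) := by
  have hbaseChange := congrArg (LinearMap.baseChange ℂ) (mvfderiv_subtypeVal_comp_mfderiv_smul g z)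
  rw [LinearMap.baseChange_comp, LinearMap.baseChange_comp] at hbaseChange
  exact LinearMap.congr_fun hbaseChange x

theorem cmfderiv_smul_eq_of_sphereInclDeriv_eq_rossiField {t : ℂ}
    {Z : ∀ z : S3, CTangentSpace (𝓡 3) z}
    (hZt : ∀ z, sphereInclDeriv z (Z z) = rossiField t z) (g : SU2) (z : S3) :
    cmfderiv (𝓡 3) (fun w : S3 ↦ g • w) z (Z z) = Z (g • z) := by
  apply sphereInclDeriv_injective (g • z)
  rw [sphereInclDeriv_cmfderiv_smul, hZt, hZt, rossiField_eq_crCombination,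
    rossiField_eq_crCombination, baseChange_toEuclideanLin_crCombination,
    sphere_smul_coe_eq_toEuclideanLin]

theorem exists_isImageBundle_rossiBundle (Γ : Subgroup SU2) [Finite Γ]
    [IsManifold (𝓡 3) ∞ (SphereQuotient Γ)] {t : ℂ} (ht : ‖t‖ ≠ 1) :
    ∃ L : ∀ q : SphereQuotient Γ, Submodule ℂ (CTangentSpace (𝓡 3) q),
      IsImageBundle (𝓡 3) (sphereProj Γ) (rossiBundle t) L ∧
      IsCRBundle (𝓡 3) L 1 ∧ IsStronglyPseudoconvex (𝓡 3) L := by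
  obtain ⟨Z, hZ, hZt⟩ := exists_cSmoothOn_sphereInclDeriv_eq_rossiField t
  have hsmul (g : Γ) : ContMDiff (𝓡 3) (𝓡 3) ∞ fun z : S3 ↦ g • z := contMDiff_sphere_smul g
  obtain ⟨Z', hZZ'⟩ := exists_cmfderiv_orbitRel_mk_eq hsmul fun g : Γ ↦
    cmfderiv_smul_eq_of_sphereInclDeriv_eq_rossiField hZt g
  have hspan : rossiBundle t = fun z ↦ Submodule.span ℂ {Z z} :=
    funext fun z ↦ rossiBundle_eq_span_singleton (hZt z)
  rw [hspan]
  exact exists_isImageBundle_isCRBundle_isStronglyPseudoconvex finrank_euclideanSpace_fin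
    (isLocalDiffeomorph_orbitRel_mk hsmul) Quotient.mk_surjective hZ hZZ'
    (linearIndependent_of_sphereInclDeriv_eq_rossiField ht hZ hZt)

end RossiSphere

theorem mainTheorem7_general (Γ : Subgroup SU2) [Finite Γ] :
    T2Space (SphereQuotient Γ) ∧ SecondCountableTopology (SphereQuotient Γ) ∧
    ∃ _ : IsManifold (𝓡 3) ∞ (SphereQuotient Γ),
      IsLocalDiffeomorph (𝓡 3) (𝓡 3) ∞ (sphereProj Γ) ∧
      ∀ t : ℂ, ‖t‖ ≠ 1 →
        ∃ L : ∀ q : SphereQuotient Γ, Submodule ℂ (CTangentSpace (𝓡 3) q),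
          IsImageBundle (𝓡 3) (sphereProj Γ) (rossiBundle t) L ∧
          IsCRBundle (𝓡 3) L 1 ∧ IsStronglyPseudoconvex (𝓡 3) L := by
  have hsmul (g : Γ) : ContMDiff (𝓡 3) (𝓡 3) ∞ fun z : S3 ↦ g • z := contMDiff_sphere_smul g
  have hmanifold : IsManifold (𝓡 3) ∞ (SphereQuotient Γ) := isManifold_orbitRel_quotient hsmul
  exact ⟨t2Space_of_properlyDiscontinuousSMul_of_t2Space,
    ContinuousConstSMul.secondCountableTopology, hmanifold, isLocalDiffeomorph_orbitRel_mk hsmul,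
    fun t ht ↦ exists_isImageBundle_rossiBundle Γ ht⟩

end

theorem mainTheorem7 (Γ : Subgroup SU2) [Finite Γ] :
    T2Space (SphereQuotient Γ) ∧ SecondCountableTopology (SphereQuotient Γ) ∧
    ∃ _ : IsManifold (𝓡 3) ∞ (SphereQuotient Γ),
      IsLocalDiffeomorph (𝓡 3) (𝓡 3) ∞ (sphereProj Γ) ∧
      (∃ L : ∀ q : SphereQuotient Γ, Submodule ℂ (CTangentSpace (𝓡 3) q),
        IsImageBundle (𝓡 3) (sphereProj Γ) standardBundle L ∧
        IsCRBundle (𝓡 3) L 1 ∧ IsStronglyPseudoconvex (𝓡 3) L) ∧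
      (∀ t : ℂ, ‖t‖ < 1 →
        ∃ L : ∀ q : SphereQuotient Γ, Submodule ℂ (CTangentSpace (𝓡 3) q),
          IsImageBundle (𝓡 3) (sphereProj Γ) (rossiBundle t) L ∧
          IsCRBundle (𝓡 3) L 1 ∧ IsStronglyPseudoconvex (𝓡 3) L) := by
  obtain ⟨hT2, hsecond, hmanifold, hproj, hL⟩ := mainTheorem7_general Γ
  exact ⟨hT2, hsecond, hmanifold, hproj,
    standardBundle_eq_rossiBundle_zero ▸ hL 0 (by simp), fun t ht ↦ hL t ht.ne⟩
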